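/- Let $d\ge 3$ be a fixed integer and let $\lambda<d$ be a fixed real number. Call a finite simple graph $G$ an $(n,d,\lambda)$ graph if it is $d$-regular on $n$ vertices and all its non-trivial eigenvalues (the eigenvalues of its adjacency matrix, with multiplicity, other than one copy of the eigenvalue $d$ carried by the constant vectors) are at most $\lambda$ in absolute value. A non-backtracking random walk of length $n$ on $G$ from a vertex $w_0$ is a random sequence $(w_0,w_1,\dots,w_n)$ in which $w_1$ is a uniformly random neighbor of $w_0$ and, for $i\ge 2$, given the past, $w_i$ is uniformly random among the neighbors of $w_{i-1}$ other than $w_{i-2}$. Let $$M=\max_{v\in V(G)}\left|\{1\le i\le n: w_i=v\}\right|$$ be the maximal number of visits of the walk to a single vertex. All logarithms without an indicated base are natural. There are a sequence $\varepsilon_n\to 0$ of real numbers and a sequence $p_n\to 1$, depending only on $d$ and $\lambda$, such that for every $n$, every $(n,d,\lambda)$ graph $G$ whose girth is larger than $10\log_{d-1}\log n$ and every starting vertex $w_0$, with probability at least $p_n$, $$M=\left(1+(1+e)\,\frac{\log\log\log n}{\log\log n}\right)\frac{\log n}{\log\log n}\quad\text{for some real } e \text{ with } |e|\le\varepsilon_n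 .$$ In other words, with high probability as $n\to\infty$, $M=\left(1+(1+o(1))\frac{\log\log\log n}{\log\log n}\right)\frac{\log n}{\log\log n}$, uniformly over all such graphs and all starting vertices. -/

import Mathlib

open Filter Topology
open scoped ENNReal Matrix

namespace NonBacktracking

universe u

variable {V : Type u} [Fintype V] [DecidableEq V] (G : SimpleGraph V) [DecidableRel G.Adj]

/-- An `(n, d, lam)` graph: a `d`-regular graph on `n` vertices, all of whose non-trivial eigenvalues
are at most `lam` in absolute value. The trivial eigenvalue `d` is the one carried by the constant
functions; the non-trivial eigenvalues (with multiplicity) are those of the adjacency operator on the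
orthogonal complement of the constants. So `d` itself counts as non-trivial as soon as its
multiplicity is at least two, and `-d` is non-trivial when the graph is bipartite. -/
structure IsNDLambda (n d : ℕ) (lam : ℝ) : Prop where
  card_eq : Fintype.card V = n
  regular : G.IsRegularOfDegree d
  abs_le : ∀ (μ : ℝ) (f : V → ℝ), f ≠ 0 → ∑ v, f v = 0 → G.adjMatrix ℝ *ᵥ f = μ • f → |μ| ≤ lam

/-- The vertices to which a non-backtracking walk can move from `cur`: all neighbours of `cur`,
except the previous vertex, if there is one. -/
def choices (prev : Option V) (cur : V) : Finset V :=
  {x ∈ G.neighborFinset cur | prev ≠ some x}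

/-- One step of the non-backtracking random walk: a uniformly random element of `choices`. (If there
is none, the walk stays where it is. This never happens if all degrees are at least two.) -/
noncomputable def step (prev : Option V) (cur : V) : PMF V :=
  if h : (choices G prev cur).Nonempty then PMF.uniformOfFinset (choices G prev cur) h
  else PMF.pure cur

/-- The law of the next `k` positions of a non-backtracking random walk which is at `cur`, and which
was at `prev` one step before (`none` at the start of the walk). -/
noncomputable def walkFrom : Option V → V → ℕ → PMF (List V)
  | _, _, 0 => PMF.pure []
  | prev, cur, k + 1 =>
    (step G prev cur).bind fun x => (walkFrom (some cur) x k).map fun l => x :: l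

/-- The law of the positions `[w₁, …, wₖ]` of the non-backtracking random walk
`(w₀, w₁, …, wₖ)` of length `k` on `G` starting at the vertex `w₀`. -/
noncomputable def walk (w₀ : V) (k : ℕ) : PMF (List V) :=
  walkFrom G none w₀ k

/-- The maximum, over all vertices `v`, of the number of indices `i` with `wᵢ = v`. -/
def maxVisits (l : List V) : ℕ :=
  Finset.univ.sup fun v => l.count v

end NonBacktracking

/-! Write L = log n. Two facts drive both bounds. The spectral gap brings the walk within 1/n² of
uniform after τ = O(L) steps (`exists_mixing`), and the girth bounds every return probability by q =
d/L⁵ (`marginal_return_le`), since short non-backtracking walks are determined by their ends. A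
visited vertex then expects O(1) returns during n steps, and returns within τ steps, which could
cluster the visits, are negligible: kτq = O(L⁻³) for k = O(L). `RapidMixing` records these facts,
and the rest of the argument uses nothing else about the graph.

Mixing comes from the recurrence A Q(s+1) = (d − 1) Q(s+2) + Q(s) for the s-step averages Q(s) of a
mean-zero function. A quadratic energy (`dotProduct_self_le_of_recurrence`) shows that Q(s) decays
exponentially.

Upper bound: the number of returns has Poisson-like tails. By `expect_visitInd_le`, k returns in n
steps have probability at most (2 + kτq)^k / k!, and a union bound over the n vertices is small at
the upper level.

Lower bound: take k periods of length T ≈ n/(kb) with b a large constant. If W is the set of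
vertices with at least j visits so far, a second moment argument shows that the next period meets at
least T|W|/(4n) distinct points of W (`expect_few_distinct_le`). Iterating, at least nθ^k vertices
have k visits, where θ = T/(4n) (`expect_few_popular_le`), and at the lower level nθ^k ≥ L³.

Both levels solve k log k = L up to O(k), which determines the second-order term. The error tends to
0 by diagonalization. -/

set_option linter.unusedSectionVars false

/-! ### Expectations and marginals of the walk. -/

namespace NonBacktracking

universe u

variable {V : Type u} [Fintype V] [DecidableEq V] (G : SimpleGraph V) [DecidableRel G.Adj]

/-- The transition probabilities of the walk, as real numbers. -/
noncomputable def stepProb (prev : Option V) (cur x : V) : ℝ := (step G prev cur x).toReal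

/-- The expectation of a function of the next `k` positions of the walk. -/
noncomputable def expect : ℕ → Option V → V → (List V → ℝ) → ℝ
  | 0, _, _, F => F []
  | k + 1, prev, cur, F =>
    ∑ x, stepProb G prev cur x * expect k (some cur) x fun l => F (x :: l)

/-- The expectation of a function of the position after `k` steps. -/
noncomputable def marginal : ℕ → Option V → V → (V → ℝ) → ℝ
  | 0, _, cur, f => f cur
  | k + 1, prev, cur, f => ∑ x, stepProb G prev cur x * marginal k (some cur) x f

/-- A state of the walk is admissible if the previous vertex, if any, is a neighbour of the current
one. -/
def Adm (prev : Option V) (cur : V) : Prop := ∀ q, prev = some q → G.Adj cur q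

/-- The state of the walk after visiting the positions in a list. -/
def advance : Option V → V → List V → Option V × V
  | prev, cur, [] => (prev, cur)
  | _, cur, x :: l => advance (some cur) x l

variable {G}

lemma adm_none (c : V) : Adm G none c := by
  intro q hq
  cases hq

lemma adm_some {c x : V} : Adm G (some c) x ↔ G.Adj x c := by
  simp [Adm]

lemma stepProb_nonneg (p : Option V) (c x : V) : 0 ≤ stepProb G p c x := ENNReal.toReal_nonneg

lemma sum_stepProb (p : Option V) (c : V) : ∑ x, stepProb G p c x = 1 := by
  unfold stepProb
  rw [← ENNReal.toReal_sum (fun x _ => PMF.apply_ne_top _ _),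
    ← tsum_fintype (L := .unconditional V), PMF.tsum_coe]
  rfl

lemma sum_stepProb_mul_const (p : Option V) (c : V) (b : ℝ) :
    ∑ x, stepProb G p c x * b = b := by
  rw [← Finset.sum_mul, sum_stepProb, one_mul]

lemma choices_none (c : V) : choices G none c = G.neighborFinset c := by
  ext x; simp [choices]

lemma choices_some (q c : V) : choices G (some q) c = (G.neighborFinset c).erase q := by
  ext x; simp [choices, eq_comm, and_comm]

variable {d : ℕ}

lemma stepProb_none (hd : 3 ≤ d) (hG : G.IsRegularOfDegree d) (c x : V) :
    stepProb G none c x = if G.Adj c x then (d : ℝ)⁻¹ else 0 := by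
  have hcard : (choices G none c).card = d := by
    rw [choices_none, SimpleGraph.card_neighborFinset_eq_degree, hG.degree_eq]
  have hne : (choices G none c).Nonempty := by
    rw [← Finset.card_pos]; omega
  rw [stepProb, step, dif_pos hne, PMF.uniformOfFinset_apply, hcard]
  by_cases h : G.Adj c x <;> simp [choices, h]

lemma stepProb_some (hd : 3 ≤ d) (hG : G.IsRegularOfDegree d) {q c : V} (hq : G.Adj c q) (x : V) :
    stepProb G (some q) c x = if G.Adj c x ∧ x ≠ q then ((d : ℝ) - 1)⁻¹ else 0 := by
  have hcard : (choices G (some q) c).card = d - 1 := by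
    rw [choices_some, Finset.card_erase_of_mem (by simpa using hq),
      SimpleGraph.card_neighborFinset_eq_degree, hG.degree_eq]
  have hne : (choices G (some q) c).Nonempty := by
    rw [← Finset.card_pos]; omega
  rw [stepProb, step, dif_pos hne, PMF.uniformOfFinset_apply, hcard, choices_some]
  by_cases h : G.Adj c x ∧ x ≠ q
  · rw [if_pos (by simpa [and_comm] using h), if_pos h, ENNReal.toReal_inv, ENNReal.toReal_natCast,
      Nat.cast_sub (by omega), Nat.cast_one]
  · rw [if_neg (by simpa [and_comm, imp_not_comm] using h), if_neg h, ENNReal.toReal_zero]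

lemma adm_of_stepProb_ne_zero (hd : 3 ≤ d) (hG : G.IsRegularOfDegree d) {p : Option V} {c x : V}
    (hp : Adm G p c) (h : stepProb G p c x ≠ 0) : Adm G (some c) x := by
  rw [adm_some]
  cases p with
  | none =>
    rw [stepProb_none hd hG] at h
    exact (by_contra fun h' => h (if_neg fun h'' => h' h''.symm))
  | some q =>
    rw [stepProb_some hd hG (hp q rfl)] at h
    exact (by_contra fun h' => h (if_neg fun h'' => h' h''.1.symm))

lemma stepProb_le (hd : 3 ≤ d) (hG : G.IsRegularOfDegree d) {p : Option V} {c : V}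
    (hp : Adm G p c) (x : V) : stepProb G p c x ≤ ((d : ℝ) - 1)⁻¹ := by
  have hd' : (3 : ℝ) ≤ d := by exact_mod_cast hd
  have h0 : (0 : ℝ) ≤ ((d : ℝ) - 1)⁻¹ := inv_nonneg.2 (by linarith)
  cases p with
  | none =>
    rw [stepProb_none hd hG]
    split_ifs
    · exact inv_anti₀ (by linarith) (by linarith)
    · exact h0
  | some q =>
    rw [stepProb_some hd hG (hp q rfl)]
    split_ifs
    · exact le_rfl
    · exact h0

/-- To compare two averages over one step it suffices to compare admissible outcomes. -/
lemma sum_stepProb_mul_le (hd : 3 ≤ d) (hG : G.IsRegularOfDegree d) {p : Option V} {c : V}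
    (hp : Adm G p c) {f g : V → ℝ} (h : ∀ x, Adm G (some c) x → f x ≤ g x) :
    ∑ x, stepProb G p c x * f x ≤ ∑ x, stepProb G p c x * g x := by
  refine Finset.sum_le_sum fun x _ => ?_
  by_cases hx : stepProb G p c x = 0
  · simp [hx]
  · exact mul_le_mul_of_nonneg_left (h x (adm_of_stepProb_ne_zero hd hG hp hx))
      (stepProb_nonneg p c x)

/-- Only lists that leave the walk in an admissible state have to be compared. Together with
`expect_append` this lets estimates be restarted from the state reached. -/
lemma expect_mono (hd : 3 ≤ d) (hG : G.IsRegularOfDegree d) {k : ℕ} {p : Option V} {c : V}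
    (hp : Adm G p c) {F F' : List V → ℝ}
    (h : ∀ l, l.length = k → Adm G (advance p c l).1 (advance p c l).2 → F l ≤ F' l) :
    expect G k p c F ≤ expect G k p c F' := by
  induction k generalizing p c F F' with
  | zero => exact h [] rfl hp
  | succ k ih =>
    refine sum_stepProb_mul_le hd hG hp fun x hx => ih hx fun l hl hl' => ?_
    exact h (x :: l) (by simp [hl]) hl'

lemma expect_const (k : ℕ) (p : Option V) (c : V) (b : ℝ) : expect G k p c (fun _ => b) = b := by
  induction k generalizing p c with
  | zero => rfl
  | succ k ih => simp only [expect, ih, sum_stepProb_mul_const]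

lemma expect_add (k : ℕ) (p : Option V) (c : V) (F F' : List V → ℝ) :
    expect G k p c (fun l => F l + F' l) = expect G k p c F + expect G k p c F' := by
  induction k generalizing p c F F' with
  | zero => rfl
  | succ k ih =>
    simp only [expect, ← Finset.sum_add_distrib, ← mul_add]
    exact Finset.sum_congr rfl fun x _ => by rw [ih]

lemma expect_const_mul (k : ℕ) (p : Option V) (c : V) (b : ℝ) (F : List V → ℝ) :
    expect G k p c (fun l => b * F l) = b * expect G k p c F := by
  induction k generalizing p c F with
  | zero => rfl
  | succ k ih =>
    simp only [expect, Finset.mul_sum]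
    exact Finset.sum_congr rfl fun x _ => by rw [ih]; ring

lemma expect_sum {ι : Type*} (s : Finset ι) (k : ℕ) (p : Option V) (c : V) (F : ι → List V → ℝ) :
    expect G k p c (fun l => ∑ i ∈ s, F i l) = ∑ i ∈ s, expect G k p c (F i) := by
  classical
  induction s using Finset.induction_on with
  | empty => simp [expect_const]
  | insert a s ha ih => simp only [Finset.sum_insert ha, expect_add, ih]

/-- The Markov property. -/
lemma expect_append (m k : ℕ) (p : Option V) (c : V) (F : List V → ℝ) :
    expect G (m + k) p c F = expect G m p c fun l =>
      expect G k (advance p c l).1 (advance p c l).2 fun l' => F (l ++ l') := by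
  induction m generalizing p c F with
  | zero => simp [expect, advance]
  | succ m ih =>
    rw [Nat.add_right_comm]
    show ∑ x, _ = ∑ x, _
    exact Finset.sum_congr rfl fun x _ => by rw [ih]; rfl

open Classical in
lemma toReal_walkFrom (k : ℕ) (p : Option V) (c : V) (S : Set (List V)) :
    ((walkFrom G p c k).toOuterMeasure S).toReal =
      expect G k p c fun l => if l ∈ S then 1 else 0 := by
  induction k generalizing p c S with
  | zero =>
    rw [walkFrom, PMF.toOuterMeasure_pure_apply]
    simp only [expect]
    split_ifs <;> simp
  | succ k ih =>
    rw [walkFrom, PMF.toOuterMeasure_bind_apply, tsum_fintype, ENNReal.toReal_sum]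
    · refine Finset.sum_congr rfl fun x _ => ?_
      rw [ENNReal.toReal_mul, PMF.toOuterMeasure_map_apply, ih]
      rfl
    · intro x _
      refine ENNReal.mul_ne_top (PMF.apply_ne_top _ _) (ne_top_of_le_ne_top ENNReal.one_ne_top ?_)
      rw [PMF.toOuterMeasure_apply]
      exact (ENNReal.tsum_le_tsum fun a => Set.indicator_le_self _ _ a).trans_eq (PMF.tsum_coe _)

lemma marginal_mono (hd : 3 ≤ d) (hG : G.IsRegularOfDegree d) {k : ℕ} {p : Option V} {c : V}
    (hp : Adm G p c) {f g : V → ℝ} (h : ∀ x, f x ≤ g x) :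
    marginal G k p c f ≤ marginal G k p c g := by
  induction k generalizing p c with
  | zero => exact h c
  | succ k ih => exact sum_stepProb_mul_le hd hG hp fun x hx => ih hx

lemma marginal_const (k : ℕ) (p : Option V) (c : V) (b : ℝ) :
    marginal G k p c (fun _ => b) = b := by
  induction k generalizing p c with
  | zero => rfl
  | succ k ih => simp only [marginal, ih, sum_stepProb_mul_const]

lemma marginal_add (k : ℕ) (p : Option V) (c : V) (f g : V → ℝ) :
    marginal G k p c (fun x => f x + g x) = marginal G k p c f + marginal G k p c g := by
  induction k generalizing p c with
  | zero => rfl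
  | succ k ih => simp only [marginal, ih, mul_add, Finset.sum_add_distrib]

lemma marginal_nonneg (hd : 3 ≤ d) (hG : G.IsRegularOfDegree d) {k : ℕ} {p : Option V} {c : V}
    (hp : Adm G p c) {f : V → ℝ} (h : ∀ x, 0 ≤ f x) : 0 ≤ marginal G k p c f := by
  rw [← marginal_const (G := G) k p c (0 : ℝ)]
  exact marginal_mono hd hG hp h

/-- A bound on the `k`-step marginals from all admissible states holds for all later times. -/
lemma marginal_le_of_le (hd : 3 ≤ d) (hG : G.IsRegularOfDegree d) {h s : ℕ} (hs : h ≤ s) {f : V → ℝ}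
    {B : ℝ} (hB : ∀ p c, Adm G p c → marginal G h p c f ≤ B) {p : Option V} {c : V}
    (hp : Adm G p c) : marginal G s p c f ≤ B := by
  induction s, hs using Nat.le_induction generalizing p c with
  | base => exact hB p c hp
  | succ s hs ih =>
    refine (sum_stepProb_mul_le hd hG hp fun x hx => ih hx).trans_eq ?_
    exact sum_stepProb_mul_const p c B

end NonBacktracking

/-! ### Girth, uniqueness of short walks, and return probabilities. -/

namespace SimpleGraph

variable {V : Type*} {G : SimpleGraph V}

/-- Below the girth, non-backtracking walks are determined by their ends. -/
lemma Walk.eq_of_isChain_of_length_lt_girth {u v : V} {p q : G.Walk u v}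
    (hp : List.IsChain (· ≠ ·) p.edges) (hq : List.IsChain (· ≠ ·) q.edges)
    (h : p.length + q.length < G.girth) : p = q := by
  classical
  -- The edges of both walks span a graph with fewer edges than the girth, hence a forest. In a
  -- forest non-backtracking walks are paths, and paths are unique.
  set s : Finset (Sym2 V) := p.edges.toFinset ∪ q.edges.toFinset with hs
  set H : SimpleGraph V := fromEdgeSet (s : Set (Sym2 V)) with hH
  have hmem : ∀ e ∈ s, e ∈ G.edgeSet := by
    intro e he
    rcases Finset.mem_union.1 he with he | he
    · exact p.edges_subset_edgeSet (List.mem_toFinset.1 he)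
    · exact q.edges_subset_edgeSet (List.mem_toFinset.1 he)
  have hedge : ∀ e, e ∈ H.edgeSet ↔ e ∈ s := by
    intro e
    rw [hH, edgeSet_fromEdgeSet]
    exact ⟨fun h => h.1, fun h => ⟨h, fun h' => G.not_isDiag_of_mem_edgeSet (hmem e h) h'⟩⟩
  have hacyc : H.IsAcyclic := by
    intro a c hc
    have hsub : ∀ e ∈ c.edges, e ∈ G.edgeSet := fun e he =>
      hmem e ((hedge e).1 (c.edges_subset_edgeSet he))
    have h1 := girth_le_length (hc.transfer (H := G) hsub)
    rw [Walk.length_transfer, ← Walk.length_edges, ← List.toFinset_card_of_nodup hc.edges_nodup] at h1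
    have h2 : c.edges.toFinset.card ≤ s.card := Finset.card_le_card fun e he =>
      (hedge e).1 (c.edges_subset_edgeSet (List.mem_toFinset.1 he))
    have h3 : s.card ≤ p.edges.length + q.edges.length :=
      (Finset.card_union_le _ _).trans
        (add_le_add (List.toFinset_card_le _) (List.toFinset_card_le _))
    rw [Walk.length_edges, Walk.length_edges] at h3
    omega
  have hpH : ∀ e ∈ p.edges, e ∈ H.edgeSet := fun e he =>
    (hedge e).2 (Finset.mem_union_left _ (List.mem_toFinset.2 he))
  have hqH : ∀ e ∈ q.edges, e ∈ H.edgeSet := fun e he =>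
    (hedge e).2 (Finset.mem_union_right _ (List.mem_toFinset.2 he))
  have hp' : (p.transfer H hpH).IsPath :=
    (hacyc.isPath_iff_isChain _).2 (by rwa [Walk.edges_transfer])
  have hq' : (q.transfer H hqH).IsPath :=
    (hacyc.isPath_iff_isChain _).2 (by rwa [Walk.edges_transfer])
  have heq := congrArg (fun r : H.Path u v => (r : H.Walk u v).support)
    ((hacyc.subsingleton_path u v).elim ⟨_, hp'⟩ ⟨_, hq'⟩)
  simp only [Walk.support_transfer] at heq
  exact Walk.ext_support heq

end SimpleGraph

namespace NonBacktracking

universe u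

variable {V : Type u} [Fintype V] [DecidableEq V] {G : SimpleGraph V} [DecidableRel G.Adj]
variable {d : ℕ}

/-- The indicator function of a set of vertices. -/
noncomputable def ind (W : Finset V) (x : V) : ℝ := if x ∈ W then 1 else 0

lemma ind_nonneg (W : Finset V) (x : V) : 0 ≤ ind W x := by
  unfold ind; split_ifs <;> norm_num

lemma ind_le_one (W : Finset V) (x : V) : ind W x ≤ 1 := by
  unfold ind; split_ifs <;> norm_num

/-- A position reached with positive probability is the end of a non-backtracking walk. -/
lemma exists_walk_of_marginal_ne_zero (hd : 3 ≤ d) (hG : G.IsRegularOfDegree d) {s : ℕ}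
    {p : Option V} {c x : V} (hp : Adm G p c) (h : marginal G s p c (ind {x}) ≠ 0) :
    ∃ w : G.Walk c x, w.length = s ∧ List.IsChain (· ≠ ·) w.edges ∧
      ∀ q, p = some q → ∀ e ∈ w.edges.head?, s(q, c) ≠ e := by
  induction s generalizing p c with
  | zero =>
    have hc : c = x := by
      by_contra hc
      exact h (by simp [marginal, ind, hc])
    subst hc
    exact ⟨SimpleGraph.Walk.nil, by simp⟩
  | succ s ih =>
    obtain ⟨y, -, hy⟩ := Finset.exists_ne_zero_of_sum_ne_zero h
    have hy1 : stepProb G p c y ≠ 0 := left_ne_zero_of_mul hy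
    have hadm := adm_of_stepProb_ne_zero hd hG hp hy1
    obtain ⟨w, hw, hchain, hhead⟩ := ih hadm (right_ne_zero_of_mul hy)
    refine ⟨SimpleGraph.Walk.cons (adm_some.1 hadm).symm w, by simp [hw], ?_, ?_⟩
    · rw [SimpleGraph.Walk.edges_cons, List.isChain_cons]
      exact ⟨hhead c rfl, hchain⟩
    · rintro q rfl e he
      simp only [SimpleGraph.Walk.edges_cons, List.head?_cons, Option.mem_some_iff] at he
      subst he
      rw [stepProb_some hd hG (hp q rfl)] at hy1
      have hyq : y ≠ q := by
        by_contra hc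
        exact hy1 (if_neg fun h' => h'.2 hc)
      intro h'
      rw [Sym2.eq_swap, Sym2.congr_right] at h'
      exact hyq h'.symm

/-- Below half the girth, the walk reaches any given vertex in at most one way. -/
lemma marginal_ind_singleton_le (hd : 3 ≤ d) (hG : G.IsRegularOfDegree d) {h : ℕ}
    (hh : 2 * h < G.girth) {p : Option V} {c x : V} (hp : Adm G p c) :
    marginal G h p c (ind {x}) ≤ (((d : ℝ) - 1)⁻¹) ^ h := by
  have hd' : (3 : ℝ) ≤ d := by exact_mod_cast hd
  have hinv : (0 : ℝ) ≤ ((d : ℝ) - 1)⁻¹ := inv_nonneg.2 (by linarith)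
  induction h generalizing p c with
  | zero => simpa [marginal] using ind_le_one {x} c
  | succ h ih =>
    by_cases h0 : marginal G (h + 1) p c (ind {x}) = 0
    · rw [h0]; positivity
    obtain ⟨y, -, hy⟩ := Finset.exists_ne_zero_of_sum_ne_zero h0
    have hwalk : ∀ z, stepProb G p c z * marginal G h (some c) z (ind {x}) ≠ 0 →
        ∃ (hcz : G.Adj c z) (w : G.Walk z x), w.length = h ∧
          List.IsChain (· ≠ ·) (SimpleGraph.Walk.cons hcz w).edges := by
      intro z hz
      have hadm := adm_of_stepProb_ne_zero hd hG hp (left_ne_zero_of_mul hz)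
      obtain ⟨w, hw, hchain, hhead⟩ :=
        exists_walk_of_marginal_ne_zero hd hG hadm (right_ne_zero_of_mul hz)
      refine ⟨(adm_some.1 hadm).symm, w, hw, ?_⟩
      rw [SimpleGraph.Walk.edges_cons, List.isChain_cons]
      exact ⟨hhead c rfl, hchain⟩
    -- Two different first steps leading to `x` would give two non-backtracking walks with the same
    -- ends and total length 2(h + 1), which is below the girth.
    have huniq : ∀ z, z ≠ y → stepProb G p c z * marginal G h (some c) z (ind {x}) = 0 := by
      intro z hzy
      by_contra hz
      obtain ⟨hcz, w, hw, hchain⟩ := hwalk z hz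
      obtain ⟨hcy, w', hw', hchain'⟩ := hwalk y hy
      have heq := SimpleGraph.Walk.eq_of_isChain_of_length_lt_girth hchain hchain'
        (by simp only [SimpleGraph.Walk.length_cons]; omega)
      have := congrArg SimpleGraph.Walk.snd heq
      simp only [SimpleGraph.Walk.snd_cons] at this
      exact hzy this
    have hadm := adm_of_stepProb_ne_zero hd hG hp (left_ne_zero_of_mul hy)
    calc marginal G (h + 1) p c (ind {x})
        = stepProb G p c y * marginal G h (some c) y (ind {x}) :=
          Finset.sum_eq_single y (fun z _ hz => huniq z hz) (by simp)
      _ ≤ ((d : ℝ) - 1)⁻¹ * (((d : ℝ) - 1)⁻¹) ^ h :=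
          mul_le_mul (stepProb_le hd hG hp y) (ih (by omega) hadm)
            (marginal_nonneg hd hG hadm (ind_nonneg _)) hinv
      _ = (((d : ℝ) - 1)⁻¹) ^ (h + 1) := by ring

/-- The return probabilities are small when the girth is large. -/
lemma marginal_return_le (hd : 3 ≤ d) (hG : G.IsRegularOfDegree d) {h : ℕ}
    (hh : 2 * h < G.girth) {p : Option V} {x : V} (hp : Adm G p x) {s : ℕ} (hs : 1 ≤ s) :
    marginal G s p x (ind {x}) ≤ (((d : ℝ) - 1)⁻¹) ^ h := by
  have hd' : (3 : ℝ) ≤ d := by exact_mod_cast hd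
  have hinv : (0 : ℝ) ≤ ((d : ℝ) - 1)⁻¹ := inv_nonneg.2 (by linarith)
  -- From time `h` on, condition on all but the last `h` steps. Before that, a closed
  -- non-backtracking walk is shorter than the girth, hence trivial.
  rcases le_or_gt h s with hle | hlt
  · exact marginal_le_of_le hd hG hle
      (fun p c hp => marginal_ind_singleton_le hd hG hh hp) hp
  · by_cases h0 : marginal G s p x (ind {x}) = 0
    · rw [h0]; positivity
    obtain ⟨w, hw, hchain, -⟩ := exists_walk_of_marginal_ne_zero hd hG hp h0
    have := SimpleGraph.Walk.eq_of_isChain_of_length_lt_girth hchain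
      (q := SimpleGraph.Walk.nil) (by simp) (by simp only [SimpleGraph.Walk.length_nil]; omega)
    rw [this, SimpleGraph.Walk.length_nil] at hw
    omega

end NonBacktracking

/-! ### The spectral gap and the recurrence for the averages. -/

namespace NonBacktracking

/-- A sequence of vectors obeying a two-term recurrence with a symmetric operator, whose
characteristic roots are all at most one in absolute value, is bounded. -/
lemma dotProduct_self_le_of_recurrence {ι : Type*} [Fintype ι] (A : Matrix ι ι ℝ) (hA : A.IsSymm)
    {α β a : ℝ} (hβ1 : β ≤ 1) (y : ℕ → ι → ℝ)
    (hrec : ∀ s, y (s + 2) = α • (A *ᵥ y (s + 1)) - β • y s)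
    (hbound : ∀ s, |2 * α * (y (s + 1) ⬝ᵥ A *ᵥ y s)| ≤
      a * (y (s + 1) ⬝ᵥ y (s + 1) + y s ⬝ᵥ y s)) (ha : a ≤ 1 + β) (s : ℕ) :
    (1 + β - a) * (y s ⬝ᵥ y s) ≤ (1 + β + a) * (y 1 ⬝ᵥ y 1 + y 0 ⬝ᵥ y 0) := by
  -- An energy for the recurrence. With z = αA y(s+1) and w = y(s), it drops in one step by exactly
  -- (1 − β)|z − (1 + β)w|². By `hbound` it lies between 1 + β − a and 1 + β + a times |y(s+1)|² +
  -- |y(s)|².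
  set Φ : ℕ → ℝ := fun s =>
    (1 + β) * (y (s + 1) ⬝ᵥ y (s + 1) + y s ⬝ᵥ y s) - 2 * α * (y (s + 1) ⬝ᵥ A *ᵥ y s) with hΦ
  have hself : ∀ z : ι → ℝ, 0 ≤ z ⬝ᵥ z := fun z => by
    simpa using dotProduct_star_self_nonneg z
  have hstep : ∀ s, Φ (s + 1) ≤ Φ s := by
    intro s
    set x := y (s + 1) with hx
    set w := y s with hw
    set z := α • (A *ᵥ x) with hz
    have h1 : α * (x ⬝ᵥ A *ᵥ w) = z ⬝ᵥ w := by
      rw [hz, smul_dotProduct, smul_eq_mul, Matrix.dotProduct_mulVec, ← Matrix.mulVec_transpose,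
        hA.eq]
    have h2 : α * (y (s + 2) ⬝ᵥ A *ᵥ x) = z ⬝ᵥ z - β * (w ⬝ᵥ z) := by
      have : α * (y (s + 2) ⬝ᵥ A *ᵥ x) = y (s + 2) ⬝ᵥ z := by
        rw [hz, dotProduct_smul, smul_eq_mul]
      rw [this, hrec s]
      simp only [sub_dotProduct, smul_dotProduct, smul_eq_mul, ← hz, ← hx, ← hw]
    have h3 : y (s + 2) ⬝ᵥ y (s + 2) = z ⬝ᵥ z - 2 * β * (z ⬝ᵥ w) + β ^ 2 * (w ⬝ᵥ w) := by
      rw [hrec s]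
      simp only [sub_dotProduct, dotProduct_sub, smul_dotProduct, dotProduct_smul, smul_eq_mul,
        ← hz, ← hx, ← hw]
      rw [dotProduct_comm w z]
      ring
    have h4 : 0 ≤ (z - (1 + β) • w) ⬝ᵥ (z - (1 + β) • w) := hself _
    simp only [sub_dotProduct, dotProduct_sub, smul_dotProduct, dotProduct_smul, smul_eq_mul] at h4
    have h5 : w ⬝ᵥ z = z ⬝ᵥ w := dotProduct_comm w z
    have h6 := mul_nonneg (sub_nonneg.2 hβ1) h4
    have e1 : Φ s = (1 + β) * (x ⬝ᵥ x + w ⬝ᵥ w) - 2 * (z ⬝ᵥ w) := by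
      rw [← h1, hΦ]; ring
    have e2 : Φ (s + 1) = (1 + β) * (y (s + 2) ⬝ᵥ y (s + 2) + x ⬝ᵥ x) -
        2 * (z ⬝ᵥ z - β * (w ⬝ᵥ z)) := by
      rw [← h2, hΦ]; ring
    rw [e1, e2, h3]
    rw [h5] at h6 ⊢
    nlinarith [h6]
  have hanti : ∀ s, Φ s ≤ Φ 0 := fun s => by
    induction s with
    | zero => exact le_rfl
    | succ s ih => exact (hstep s).trans ih
  have h0 : Φ 0 ≤ (1 + β + a) * (y 1 ⬝ᵥ y 1 + y 0 ⬝ᵥ y 0) := by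
    have := neg_le_of_abs_le (hbound 0)
    simp only [hΦ, zero_add] at this ⊢
    linarith
  have h1 : (1 + β - a) * (y (s + 1) ⬝ᵥ y (s + 1) + y s ⬝ᵥ y s) ≤ Φ s := by
    have := le_of_abs_le (hbound s)
    simp only [hΦ]
    linarith
  have h2 : 0 ≤ (1 + β - a) * (y (s + 1) ⬝ᵥ y (s + 1)) :=
    mul_nonneg (by linarith) (hself _)
  linarith [hanti s]

universe u

variable {V : Type u} [Fintype V] [DecidableEq V] {G : SimpleGraph V} [DecidableRel G.Adj]
variable {n d : ℕ} {lam : ℝ}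

lemma sum_adjMatrix_mulVec (hG : G.IsRegularOfDegree d) (g : V → ℝ) :
    ∑ v, (G.adjMatrix ℝ *ᵥ g) v = d * ∑ v, g v := by
  simp only [SimpleGraph.adjMatrix_mulVec_apply, SimpleGraph.neighborFinset_eq_filter,
    Finset.sum_filter]
  rw [Finset.sum_comm, Finset.mul_sum]
  refine Finset.sum_congr rfl fun v _ => ?_
  rw [← Finset.sum_filter, Finset.sum_const, nsmul_eq_mul]
  congr 2
  rw [← hG.degree_eq v, ← SimpleGraph.card_neighborFinset_eq_degree,
    SimpleGraph.neighborFinset_eq_filter]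
  simp only [SimpleGraph.adj_comm]

/-- The adjacency operator contracts by the second eigenvalue on functions with mean zero. -/
lemma IsNDLambda.dotProduct_mulVec_le (hG : IsNDLambda G n d lam) (hlam : lam < d) {Λ : ℝ}
    (hΛ : lam ≤ Λ) {f : V → ℝ} (hf : ∑ v, f v = 0) :
    (G.adjMatrix ℝ *ᵥ f) ⬝ᵥ (G.adjMatrix ℝ *ᵥ f) ≤ Λ ^ 2 * (f ⬝ᵥ f) := by
  set A := G.adjMatrix ℝ with hAdef
  have hA : A.IsHermitian := G.isHermitian_adjMatrix ℝ
  have hsymm : A.IsSymm := G.isSymm_adjMatrix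
  set b := hA.eigenvectorBasis with hb
  have hnorm : ∀ g : V → ℝ, g ⬝ᵥ g = ∑ i, ((b i).ofLp ⬝ᵥ g) ^ 2 := by
    intro g
    have h := b.sum_sq_norm_inner_right (WithLp.toLp 2 g)
    rw [EuclideanSpace.real_norm_sq_eq] at h
    simp only [EuclideanSpace.inner_eq_star_dotProduct, star_trivial, Real.norm_eq_abs,
      sq_abs] at h
    rw [dotProduct]
    simp only [← pow_two]
    rw [← h]
    exact Finset.sum_congr rfl fun i _ => by rw [dotProduct_comm]
  have hcoef : ∀ i, (b i).ofLp ⬝ᵥ (A *ᵥ f) = hA.eigenvalues i * ((b i).ofLp ⬝ᵥ f) := by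
    intro i
    rw [Matrix.dotProduct_mulVec, ← Matrix.mulVec_transpose, hsymm.eq, hb,
      hA.mulVec_eigenvectorBasis, smul_dotProduct, smul_eq_mul]
  have hsum := sum_adjMatrix_mulVec hG.regular
  have hterm : ∀ i, ((b i).ofLp ⬝ᵥ (A *ᵥ f)) ^ 2 ≤ Λ ^ 2 * ((b i).ofLp ⬝ᵥ f) ^ 2 := by
    intro i
    rw [hcoef, mul_pow]
    set e := (b i).ofLp with he
    have hev : A *ᵥ e = hA.eigenvalues i • e := hA.mulVec_eigenvectorBasis i
    have hene : e ≠ 0 := by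
      intro h0
      have : b i = 0 := by
        ext v; exact congrFun h0 v
      exact b.orthonormal.ne_zero i this
    by_cases hse : ∑ v, e v = 0
    · have h1 := (hG.abs_le _ e hene hse hev).trans hΛ
      have h2 : (hA.eigenvalues i) ^ 2 ≤ Λ ^ 2 := by
        rw [← sq_abs]
        exact pow_le_pow_left₀ (abs_nonneg _) h1 2
      exact mul_le_mul_of_nonneg_right h2 (sq_nonneg _)
    -- The eigenbasis need not contain a constant vector. An eigenvector with nonzero sum has
    -- eigenvalue d, and its mean-zero part, if nonzero, would make d a non-trivial eigenvalue,
    -- against `lam < d`. So it is constant, hence orthogonal to `f`.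
    · have hmu : hA.eigenvalues i = d := by
        have h1 := hsum e
        rw [hev] at h1
        simp only [Pi.smul_apply, smul_eq_mul, ← Finset.mul_sum] at h1
        exact mul_right_cancel₀ hse h1
      have hn : (0 : ℝ) < Fintype.card V := by
        have : Nonempty V := by
          by_contra hV
          rw [not_nonempty_iff] at hV
          exact hse (by simp)
        exact_mod_cast Fintype.card_pos
      set m : ℝ := (∑ v, e v) / Fintype.card V with hm
      set g : V → ℝ := e - Function.const V m with hg
      have hg0 : ∑ v, g v = 0 := by
        simp only [hg, Pi.sub_apply, Function.const_apply, Finset.sum_sub_distrib,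
          Finset.sum_const, Finset.card_univ, nsmul_eq_mul, hm]
        field_simp
        ring
      have hAg : A *ᵥ g = (d : ℝ) • g := by
        rw [hg, Matrix.mulVec_sub, hev, hmu, smul_sub]
        congr 1
        funext v
        exact SimpleGraph.adjMatrix_mulVec_const_apply_of_regular hG.regular
      have hgz : g = 0 := by
        by_contra hgz
        have := hG.abs_le d g hgz hg0 hAg
        rw [abs_of_nonneg (Nat.cast_nonneg d)] at this
        linarith
      have hem : e = Function.const V m := by
        rw [hg, sub_eq_zero] at hgz
        exact hgz
      have : e ⬝ᵥ f = 0 := by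
        rw [hem]
        simp [dotProduct, ← Finset.mul_sum, hf]
      simp [this]
  rw [hnorm f, hnorm (A *ᵥ f), Finset.mul_sum]
  exact Finset.sum_le_sum fun i _ => hterm i

section Recurrence

variable (hd : 3 ≤ d) (hG : G.IsRegularOfDegree d) (f : V → ℝ)

include hd hG

lemma mul_marginal_succ_none (s : ℕ) (c : V) :
    d * marginal G (s + 1) none c f = ∑ x ∈ G.neighborFinset c, marginal G s (some c) x f := by
  have hd' : (d : ℝ) ≠ 0 := by positivity
  simp only [marginal, stepProb_none hd hG, Finset.mul_sum,
    SimpleGraph.neighborFinset_eq_filter, Finset.sum_filter]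
  refine Finset.sum_congr rfl fun x _ => ?_
  split_ifs
  · field_simp
  · simp

/-- The sum over the allowed neighbours is the sum over all neighbours minus the term of `q`. -/
lemma mul_marginal_succ_some (s : ℕ) {q c : V} (hq : G.Adj c q) :
    ((d : ℝ) - 1) * marginal G (s + 1) (some q) c f =
      d * marginal G (s + 1) none c f - marginal G s (some c) q f := by
  have hd' : (d : ℝ) - 1 ≠ 0 := by
    have : (3 : ℝ) ≤ d := by exact_mod_cast hd
    linarith
  have hmem : q ∈ G.neighborFinset c := by simpa using hq
  rw [mul_marginal_succ_none hd hG, ← Finset.sum_erase_add _ _ hmem, add_sub_cancel_right,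
    ← choices_some, choices, SimpleGraph.neighborFinset_eq_filter, Finset.filter_filter,
    Finset.sum_filter]
  simp only [marginal, stepProb_some hd hG hq, Finset.mul_sum]
  refine Finset.sum_congr rfl fun x _ => ?_
  have : (G.Adj c x ∧ some q ≠ some x) ↔ (G.Adj c x ∧ x ≠ q) := by simp [eq_comm]
  by_cases h : G.Adj c x ∧ x ≠ q
  · rw [if_pos h, if_pos (this.2 h)]
    field_simp
  · rw [if_neg h, if_neg (mt this.1 h)]
    simp

/-- A uniformly random previous vertex makes the next step uniform over all neighbours, so the past
is forgotten. -/
lemma sum_marginal_some (s : ℕ) (c : V) :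
    ∑ x ∈ G.neighborFinset c, marginal G s (some x) c f = d * marginal G s none c f := by
  have hcard : ((G.neighborFinset c).card : ℝ) = d := by
    rw [SimpleGraph.card_neighborFinset_eq_degree, hG.degree_eq]
  cases s with
  | zero => simp [marginal, ← hcard]
  | succ s =>
    have hd' : (d : ℝ) - 1 ≠ 0 := by
      have : (3 : ℝ) ≤ d := by exact_mod_cast hd
      linarith
    apply mul_left_cancel₀ hd'
    rw [Finset.mul_sum, Finset.sum_congr rfl fun x hx =>
      mul_marginal_succ_some hd hG f s ((G.mem_neighborFinset c x).1 hx)]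
    rw [Finset.sum_sub_distrib, ← mul_marginal_succ_none hd hG, Finset.sum_const, nsmul_eq_mul,
      hcard]
    ring

/-- The recurrence behind mixing. A walk from a neighbour `x` of `c` either avoids `c` in its first
step, and then prolongs to a non-backtracking walk from `c` with one more step, or moves to `c` and
has `s` steps left. -/
lemma adjMatrix_mulVec_marginal (s : ℕ) :
    G.adjMatrix ℝ *ᵥ (fun c => marginal G (s + 1) none c f) =
      fun c => ((d : ℝ) - 1) * marginal G (s + 2) none c f + marginal G s none c f := by
  have hd' : (d : ℝ) ≠ 0 := by positivity
  funext c
  apply mul_left_cancel₀ hd'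
  rw [SimpleGraph.adjMatrix_mulVec_apply, Finset.mul_sum]
  have h : ∀ x ∈ G.neighborFinset c, (d : ℝ) * marginal G (s + 1) none x f =
      ((d : ℝ) - 1) * marginal G (s + 1) (some c) x f + marginal G s (some x) c f := by
    intro x hx
    have hx' : G.Adj x c := ((G.mem_neighborFinset c x).1 hx).symm
    rw [mul_marginal_succ_some hd hG f s hx']
    ring
  rw [Finset.sum_congr rfl h, Finset.sum_add_distrib, ← Finset.mul_sum,
    ← mul_marginal_succ_none hd hG, sum_marginal_some hd hG]
  ring

lemma adjMatrix_mulVec_self :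
    G.adjMatrix ℝ *ᵥ f = fun c => (d : ℝ) * marginal G 1 none c f := by
  funext c
  rw [mul_marginal_succ_none hd hG, SimpleGraph.adjMatrix_mulVec_apply]
  rfl

lemma sum_marginal_none {f : V → ℝ} (hf : ∑ v, f v = 0) (s : ℕ) :
    ∑ c, marginal G s none c f = 0 := by
  have hd0 : (d : ℝ) ≠ 0 := by positivity
  have hd' : (d : ℝ) - 1 ≠ 0 := by
    have : (3 : ℝ) ≤ d := by exact_mod_cast hd
    linarith
  induction s using Nat.twoStepInduction with
  | zero => exact hf
  | one =>
    have := sum_adjMatrix_mulVec hG f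
    rw [adjMatrix_mulVec_self hd hG, hf, mul_zero, ← Finset.mul_sum] at this
    exact (mul_eq_zero.1 this).resolve_left hd0
  | more s ih1 ih2 =>
    have := sum_adjMatrix_mulVec hG fun c => marginal G (s + 1) none c f
    rw [adjMatrix_mulVec_marginal hd hG, ih2, mul_zero, Finset.sum_add_distrib, ih1, add_zero,
      ← Finset.mul_sum] at this
    exact (mul_eq_zero.1 this).resolve_left hd'

end Recurrence

end NonBacktracking

/-! ### Exponential mixing. -/

namespace NonBacktracking

/-- A rate at which the non-backtracking walk mixes on `(n, d, lam)` graphs. -/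
lemma exists_mixing_rate {d : ℕ} (hd : 3 ≤ d) {lam : ℝ} (hlam : lam < d) :
    ∃ Λ r : ℝ, 0 < Λ ∧ Λ ≤ d ∧ lam ≤ Λ ∧ 0 < r ∧ r < 1 ∧ (((d : ℝ) - 1) * r ^ 2)⁻¹ ≤ 1 ∧
      Λ * (((d : ℝ) - 1) * r)⁻¹ < 1 + (((d : ℝ) - 1) * r ^ 2)⁻¹ := by
  have hd' : (3 : ℝ) ≤ d := by exact_mod_cast hd
  have hd1 : (d : ℝ) - 1 ≠ 0 := by linarith
  have hΛd : max lam 1 < (d : ℝ) := max_lt hlam (by linarith)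
  -- The maximum with 1 keeps the bound positive when `lam` is not.
  refine ⟨max lam 1, ?_⟩
  have hpos : (0 : ℝ) < max lam 1 := lt_of_lt_of_le one_pos (le_max_right _ _)
  have c1 : ContinuousAt (fun r : ℝ => (((d : ℝ) - 1) * r ^ 2)⁻¹) 1 :=
    ContinuousAt.inv₀ (by fun_prop) (by simpa using hd1)
  have c2 : ContinuousAt (fun r : ℝ => max lam 1 * (((d : ℝ) - 1) * r)⁻¹) 1 :=
    ContinuousAt.mul (by fun_prop) (ContinuousAt.inv₀ (by fun_prop) (by simpa using hd1))
  have hb : ((d : ℝ) - 1)⁻¹ < 1 := inv_lt_one_of_one_lt₀ (by linarith)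
  have e1 : ∀ᶠ r in 𝓝 (1 : ℝ), (((d : ℝ) - 1) * r ^ 2)⁻¹ < 1 :=
    c1.eventually_lt continuousAt_const (by simpa using hb)
  -- At r = 1 this reads Λ/(d − 1) < d/(d − 1), which is the spectral gap. By continuity it persists
  -- for some r < 1.
  have e2 : ∀ᶠ r in 𝓝 (1 : ℝ), max lam 1 * (((d : ℝ) - 1) * r)⁻¹ < 1 + (((d : ℝ) - 1) * r ^ 2)⁻¹ := by
    refine c2.eventually_lt (continuousAt_const.add c1) ?_
    simp only [mul_one, one_pow]
    have h1 : (1 : ℝ) + ((d : ℝ) - 1)⁻¹ = d * ((d : ℝ) - 1)⁻¹ := by field_simp; ring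
    rw [h1]
    exact mul_lt_mul_of_pos_right hΛd (inv_pos.2 (by linarith))
  have e3 : ∀ᶠ r in 𝓝 (1 : ℝ), 0 < r := lt_mem_nhds one_pos
  have hev : ∀ᶠ r in 𝓝[<] (1 : ℝ), 0 < r ∧ r < 1 ∧ (((d : ℝ) - 1) * r ^ 2)⁻¹ < 1 ∧
      max lam 1 * (((d : ℝ) - 1) * r)⁻¹ < 1 + (((d : ℝ) - 1) * r ^ 2)⁻¹ := by
    filter_upwards [nhdsWithin_le_nhds e1, nhdsWithin_le_nhds e2, nhdsWithin_le_nhds e3,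
      self_mem_nhdsWithin] with r h1 h2 h3 h4
    exact ⟨h3, h4, h1, h2⟩
  obtain ⟨r, h1, h2, h3, h4⟩ := hev.exists
  exact ⟨r, hpos, hΛd.le, le_max_left _ _, h1, h2, h3.le, h4⟩

universe u

variable {V : Type u} [Fintype V] [DecidableEq V] {G : SimpleGraph V} [DecidableRel G.Adj]
variable {n d : ℕ} {lam : ℝ}

/-- Starting from a vertex, the averages of a function with mean zero decay exponentially. -/
lemma IsNDLambda.marginal_none_decay (hG : IsNDLambda G n d lam) (hd : 3 ≤ d) (hlam : lam < d)
    {Λ r : ℝ} (hΛ0 : 0 < Λ) (hΛd : Λ ≤ d) (hΛ : lam ≤ Λ) (hr : 0 < r)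
    (hβ : (((d : ℝ) - 1) * r ^ 2)⁻¹ ≤ 1)
    (ha : Λ * (((d : ℝ) - 1) * r)⁻¹ < 1 + (((d : ℝ) - 1) * r ^ 2)⁻¹)
    {f : V → ℝ} (hf : ∑ v, f v = 0) (s : ℕ) (c : V) :
    (marginal G s none c f) ^ 2 ≤
      4 * (1 + (r ^ 2)⁻¹) / (1 + (((d : ℝ) - 1) * r ^ 2)⁻¹ - Λ * (((d : ℝ) - 1) * r)⁻¹) *
        (r ^ s) ^ 2 * ∑ v, f v ^ 2 := by
  have hd' : (3 : ℝ) ≤ d := by exact_mod_cast hd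
  have hd1 : 0 < (d : ℝ) - 1 := by linarith
  set A := G.adjMatrix ℝ with hA
  set α := (((d : ℝ) - 1) * r)⁻¹ with hα
  set β := (((d : ℝ) - 1) * r ^ 2)⁻¹ with hβdef
  have hα0 : 0 < α := by positivity
  have hβ0 : 0 < β := by positivity
  -- After division by `r ^ s`, boundedness of `y` is decay of the averages at rate `r`.
  set y : ℕ → V → ℝ := fun s => (r ^ s)⁻¹ • fun c => marginal G s none c f with hy
  have hQ : ∀ s, (A *ᵥ fun c => marginal G s none c f) ⬝ᵥ (A *ᵥ fun c => marginal G s none c f) ≤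
      Λ ^ 2 * ((fun c => marginal G s none c f) ⬝ᵥ fun c => marginal G s none c f) := fun s =>
    hG.dotProduct_mulVec_le hlam hΛ (sum_marginal_none hd hG.regular hf s)
  have hself : ∀ z : V → ℝ, 0 ≤ z ⬝ᵥ z := fun z => by
    simpa using dotProduct_star_self_nonneg z
  have hAy : ∀ s, (A *ᵥ y s) ⬝ᵥ (A *ᵥ y s) ≤ Λ ^ 2 * (y s ⬝ᵥ y s) := by
    intro s
    have h1 := mul_le_mul_of_nonneg_left (hQ s) (sq_nonneg ((r ^ s)⁻¹))
    simp only [hy, Matrix.mulVec_smul, smul_dotProduct, dotProduct_smul, smul_eq_mul]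
    linarith
  have hrec : ∀ s, y (s + 2) = α • (A *ᵥ y (s + 1)) - β • y s := by
    intro s
    simp only [hy, Matrix.mulVec_smul, hA, adjMatrix_mulVec_marginal hd hG.regular]
    funext c
    simp only [Pi.smul_apply, Pi.sub_apply, smul_eq_mul, hα, hβdef]
    field_simp
    ring
  have hbound : ∀ s, |2 * α * (y (s + 1) ⬝ᵥ A *ᵥ y s)| ≤
      Λ * α * (y (s + 1) ⬝ᵥ y (s + 1) + y s ⬝ᵥ y s) := by
    intro s
    have h1 := hAy s
    set x := y (s + 1)
    set w := y s
    set z := A *ᵥ w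
    have h2 := hself (Λ • x - z)
    have h3 := hself (Λ • x + z)
    simp only [sub_dotProduct, dotProduct_sub, smul_dotProduct, dotProduct_smul, smul_eq_mul,
      add_dotProduct, dotProduct_add] at h2 h3
    rw [dotProduct_comm z x] at h2 h3
    have h4 : 2 * |x ⬝ᵥ z| ≤ Λ * (x ⬝ᵥ x + w ⬝ᵥ w) := by
      have h5 : Λ * (2 * |x ⬝ᵥ z|) ≤ Λ * (Λ * (x ⬝ᵥ x + w ⬝ᵥ w)) := by
        rcases abs_cases (x ⬝ᵥ z) with h | h <;> rw [h.1] <;> nlinarith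
      exact le_of_mul_le_mul_left h5 hΛ0
    rw [abs_mul, abs_of_pos (by positivity : 0 < 2 * α)]
    nlinarith [mul_le_mul_of_nonneg_left h4 hα0.le]
  have hmain := dotProduct_self_le_of_recurrence A (G.isSymm_adjMatrix) hβ y hrec hbound
    ha.le s
  have hy0 : y 0 ⬝ᵥ y 0 = f ⬝ᵥ f := by
    simp [hy, marginal]
  have hy1 : y 1 ⬝ᵥ y 1 ≤ (r ^ 2)⁻¹ * (f ⬝ᵥ f) := by
    have h1 := hG.dotProduct_mulVec_le hlam hΛ hf
    rw [adjMatrix_mulVec_self hd hG.regular] at h1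
    set Q : V → ℝ := fun c => marginal G 1 none c f with hQdef
    have h2 : (fun c => (d : ℝ) * marginal G 1 none c f) = (d : ℝ) • Q := by
      funext c; simp [hQdef]
    rw [h2] at h1
    simp only [smul_dotProduct, dotProduct_smul, smul_eq_mul] at h1
    have h3 : Λ ^ 2 * (f ⬝ᵥ f) ≤ (d : ℝ) ^ 2 * (f ⬝ᵥ f) :=
      mul_le_mul_of_nonneg_right (pow_le_pow_left₀ hΛ0.le hΛd 2) (hself f)
    have h4 : Q ⬝ᵥ Q ≤ f ⬝ᵥ f := by
      have : (d : ℝ) ^ 2 * (Q ⬝ᵥ Q) ≤ (d : ℝ) ^ 2 * (f ⬝ᵥ f) := by linarith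
      exact le_of_mul_le_mul_left this (by positivity)
    have h5 : y 1 ⬝ᵥ y 1 = (r ^ 2)⁻¹ * (Q ⬝ᵥ Q) := by
      simp only [hy, pow_one, smul_dotProduct, dotProduct_smul, smul_eq_mul]
      rw [← mul_assoc, ← mul_inv, ← pow_two]
    rw [h5]
    exact mul_le_mul_of_nonneg_left h4 (by positivity)
  have hff : f ⬝ᵥ f = ∑ v, f v ^ 2 := by simp [dotProduct, pow_two]
  have hc : (marginal G s none c f) ^ 2 ≤ (r ^ s) ^ 2 * (y s ⬝ᵥ y s) := by
    have h1 : y s ⬝ᵥ y s = ((r ^ s) ^ 2)⁻¹ * ∑ c, (marginal G s none c f) ^ 2 := by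
      simp only [hy, dotProduct, Pi.smul_apply, smul_eq_mul, Finset.mul_sum]
      refine Finset.sum_congr rfl fun c _ => ?_
      field_simp
    rw [h1, ← mul_assoc, mul_inv_cancel₀ (by positivity), one_mul]
    exact Finset.single_le_sum (f := fun c => (marginal G s none c f) ^ 2)
      (fun c _ => sq_nonneg _) (Finset.mem_univ c)
  have hpos : 0 < 1 + β - Λ * α := by linarith
  have h6 : (1 + β + Λ * α) * (y 1 ⬝ᵥ y 1 + y 0 ⬝ᵥ y 0) ≤
      4 * ((1 + (r ^ 2)⁻¹) * (f ⬝ᵥ f)) := by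
    refine mul_le_mul (by linarith) (by rw [hy0]; linarith) ?_ (by norm_num)
    linarith [hself (y 0), hself (y 1)]
  have h7 : y s ⬝ᵥ y s ≤ 4 * (1 + (r ^ 2)⁻¹) / (1 + β - Λ * α) * (f ⬝ᵥ f) := by
    rw [div_mul_eq_mul_div, le_div_iff₀ hpos]
    linarith
  rw [← hff]
  calc (marginal G s none c f) ^ 2 ≤ (r ^ s) ^ 2 * (y s ⬝ᵥ y s) := hc
    _ ≤ (r ^ s) ^ 2 * (4 * (1 + (r ^ 2)⁻¹) / (1 + β - Λ * α) * (f ⬝ᵥ f)) :=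
        mul_le_mul_of_nonneg_left h7 (by positivity)
    _ = _ := by ring

/-- The walk on an `(n, d, lam)` graph mixes exponentially fast from every admissible state, at a
rate that depends only on `d` and `lam`. -/
theorem exists_mixing {d : ℕ} (hd : 3 ≤ d) {lam : ℝ} (hlam : lam < d) :
    ∃ K r : ℝ, 0 < K ∧ 0 < r ∧ r < 1 ∧ ∀ (n : ℕ) (V : Type u) [Fintype V] [DecidableEq V]
      (G : SimpleGraph V) [DecidableRel G.Adj], IsNDLambda G n d lam →
      ∀ (p : Option V) (c : V), Adm G p c → ∀ (W : Finset V) (s : ℕ),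
        |marginal G s p c (ind W) - (W.card : ℝ) / n| ≤ K * r ^ s * √n := by
  obtain ⟨Λ, r, hΛ0, hΛd, hΛ, hr, hr1, hβ, ha⟩ := exists_mixing_rate hd hlam
  set K2 := 4 * (1 + (r ^ 2)⁻¹) / (1 + (((d : ℝ) - 1) * r ^ 2)⁻¹ - Λ * (((d : ℝ) - 1) * r)⁻¹)
    with hK2
  have hd' : (3 : ℝ) ≤ d := by exact_mod_cast hd
  have hd1 : 0 < (d : ℝ) - 1 := by linarith
  have hK2pos : 0 < K2 := div_pos (by positivity) (by linarith)
  set K1 := √K2 + 1 with hK1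
  have hK1' : 1 ≤ K1 := by simp [hK1]
  have h1r : 0 < 1 - r := by linarith
  -- Chosen so that `2 * K1 + K * r = K`, which closes the induction for states with a previous
  -- vertex.
  set K := 2 * K1 / (1 - r) with hK
  have hKr : 2 * K1 + K * r = K := by
    rw [hK]; field_simp; ring
  have hKK1 : K1 ≤ K := by
    rw [hK, le_div_iff₀ h1r]; nlinarith
  refine ⟨K, r, by linarith, hr, hr1, ?_⟩
  intro n V _ _ G _ hG p c hp W
  have hn : (0 : ℝ) < n := by
    rw [← hG.card_eq]
    exact_mod_cast Fintype.card_pos_iff.2 ⟨c⟩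
  have hn1 : (1 : ℝ) ≤ √n := by
    rw [Real.one_le_sqrt]
    have : 0 < n := by exact_mod_cast hn
    exact_mod_cast this
  have hcardV : (Fintype.card V : ℝ) = n := by rw [hG.card_eq]
  set m : ℝ := (W.card : ℝ) / n with hm
  have hm0 : 0 ≤ m := by positivity
  have hm1 : m ≤ 1 := by
    rw [hm, div_le_one hn, ← hcardV]
    exact_mod_cast W.card_le_univ
  have hdev : ∀ v, |ind W v - m| ≤ 1 := fun v => by
    rw [abs_le]
    constructor <;> linarith [ind_nonneg W v, ind_le_one W v]
  have hnone : ∀ s c, |marginal G s none c (ind W) - m| ≤ K1 * r ^ s * √n := by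
    intro s c
    have hf : ∑ v, (ind W v + -m) = 0 := by
      rw [Finset.sum_add_distrib, Finset.sum_const, Finset.card_univ, nsmul_eq_mul, hcardV]
      simp only [ind, Finset.sum_ite_mem, Finset.univ_inter, Finset.sum_const, nsmul_eq_mul,
        mul_one, hm]
      field_simp
      ring
    have h1 := hG.marginal_none_decay hd hlam hΛ0 hΛd hΛ hr hβ ha hf s c
    rw [marginal_add, marginal_const, ← sub_eq_add_neg, ← hK2] at h1
    have h2 : ∑ v, (ind W v + -m) ^ 2 ≤ n := by
      rw [← hcardV, ← Finset.card_univ, ← nsmul_one, ← Finset.sum_const]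
      refine Finset.sum_le_sum fun v _ => ?_
      rw [← sub_eq_add_neg, ← sq_abs]
      exact pow_le_one₀ (abs_nonneg _) (hdev v)
    have h3 : (marginal G s none c (ind W) - m) ^ 2 ≤ (√K2 * r ^ s * √n) ^ 2 := by
      rw [mul_pow, mul_pow, Real.sq_sqrt hK2pos.le, Real.sq_sqrt hn.le]
      exact h1.trans (mul_le_mul_of_nonneg_left h2 (by positivity))
    refine (abs_le_of_sq_le_sq h3 (by positivity)).trans ?_
    have : √K2 ≤ K1 := by simp [hK1]
    gcongr
  intro s
  cases p with
  | none =>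
    refine (hnone s c).trans ?_
    gcongr
  | some q =>
    have hq : G.Adj c q := hp q rfl
    clear hp
    induction s generalizing q c with
    | zero =>
      simp only [marginal, pow_zero, mul_one]
      refine (hdev c).trans ?_
      nlinarith
    | succ s ih =>
      have h1 := mul_marginal_succ_some hd hG.regular (ind W) s hq
      have h2 := hnone (s + 1) c
      have h3 := ih q c hq.symm
      have h4 : ((d : ℝ) - 1) * (marginal G (s + 1) (some q) c (ind W) - m) =
          d * (marginal G (s + 1) none c (ind W) - m) - (marginal G s (some c) q (ind W) - m) := by
        rw [mul_sub, h1]; ring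
      have h5 : ((d : ℝ) - 1) * |marginal G (s + 1) (some q) c (ind W) - m| ≤
          d * (K1 * r ^ (s + 1) * √n) + K * r ^ s * √n := by
        rw [← abs_of_pos hd1, ← abs_mul, h4]
        refine (abs_sub _ _).trans (add_le_add ?_ h3)
        rw [abs_mul, abs_of_nonneg (by linarith : (0 : ℝ) ≤ d)]
        exact mul_le_mul_of_nonneg_left h2 (by linarith)
      have h6 : 1 ≤ ((d : ℝ) - 1) * r ^ 2 := by
        rwa [inv_le_one₀ (by positivity)] at hβ
      have hz : 0 ≤ r ^ s * √n := by positivity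
      have h7 : d * (K1 * r ^ (s + 1) * √n) + K * r ^ s * √n ≤
          ((d : ℝ) - 1) * (K * r ^ (s + 1) * √n) := by
        have h8 : d * (K1 * r) + K ≤ ((d : ℝ) - 1) * (K * r) := by
          have h9 : K ≤ ((d : ℝ) - 1) * r ^ 2 * K := le_mul_of_one_le_left (by linarith) h6
          have h10 : d * (K1 * r) ≤ ((d : ℝ) - 1) * (2 * K1 * r) := by
            have : 0 ≤ K1 * r := by positivity
            nlinarith
          calc d * (K1 * r) + K ≤ ((d : ℝ) - 1) * (2 * K1 * r) + ((d : ℝ) - 1) * r ^ 2 * K :=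
                add_le_add h10 h9
            _ = ((d : ℝ) - 1) * ((2 * K1 + K * r) * r) := by ring
            _ = _ := by rw [hKr]
        have := mul_le_mul_of_nonneg_right h8 hz
        rw [pow_succ]
        linarith
      exact le_of_mul_le_mul_left (h5.trans h7) hd1

end NonBacktracking

/-! ### The upper tail: factorial decay of the number of returns. -/

namespace NonBacktracking

universe u

variable {V : Type u} [Fintype V] [DecidableEq V] {G : SimpleGraph V} [DecidableRel G.Adj]
variable {d : ℕ}

/-- Quantitative assumptions on a walk on `n` vertices: after `τ` steps it is nearly uniform, and
every return probability is at most `q`. -/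
structure RapidMixing (G : SimpleGraph V) [DecidableRel G.Adj] (d n τ : ℕ) (q : ℝ) : Prop where
  three_le : 3 ≤ d
  regular : G.IsRegularOfDegree d
  card_eq : Fintype.card V = n
  pos : 0 < n
  one_le_time : 1 ≤ τ
  nonneg : 0 ≤ q
  mix : ∀ p c, Adm G p c → ∀ (W : Finset V) (s : ℕ), τ ≤ s →
    |marginal G s p c (ind W) - (W.card : ℝ) / n| ≤ 1 / (n : ℝ) ^ 2
  return_le : ∀ p x, Adm G p x → ∀ s, 1 ≤ s → marginal G s p x (ind {x}) ≤ q

/-- Additive functionals of the walk are sums over the marginals. -/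
lemma sum_stepProb_mul_add_sum_marginal (f : V → ℝ) (B : ℕ → ℝ) (T : ℕ) (p : Option V) (c : V) :
    ∑ x, stepProb G p c x * (f x * B T +
      ∑ s ∈ Finset.range T, marginal G (s + 1) (some c) x f * B (T - 1 - s)) =
    ∑ s ∈ Finset.range (T + 1), marginal G (s + 1) p c f * B (T + 1 - 1 - s) := by
  rw [Finset.sum_range_succ']
  simp only [mul_add, Finset.sum_add_distrib, Finset.mul_sum]
  rw [add_comm, Finset.sum_comm]
  congr 1
  · refine Finset.sum_congr rfl fun s _ => ?_
    rw [marginal, Finset.sum_mul]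
    refine Finset.sum_congr rfl fun x _ => ?_
    rw [show T + 1 - 1 - (s + 1) = T - 1 - s by omega]
    ring
  · rw [marginal, Finset.sum_mul]
    refine Finset.sum_congr rfl fun x _ => ?_
    simp only [marginal, Nat.add_sub_cancel, Nat.sub_zero]
    ring

/-- The indicator of at least `k` visits to `v`. -/
noncomputable def visitInd (k : ℕ) (v : V) (l : List V) : ℝ := if k ≤ l.count v then 1 else 0

lemma visitInd_nonneg (k : ℕ) (v : V) (l : List V) : 0 ≤ visitInd k v l := by
  unfold visitInd; split_ifs <;> norm_num

/-- Decomposition according to the first visit. -/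
lemma expect_visitInd_succ_le (hd : 3 ≤ d) (hG : G.IsRegularOfDegree d) {k : ℕ} {v : V} {B : ℕ → ℝ}
    (hB0 : ∀ T, 0 ≤ B T)
    (hB : ∀ T p, Adm G p v → expect G T p v (visitInd k v) ≤ B T) (T : ℕ) {p : Option V} {c : V}
    (hp : Adm G p c) :
    expect G T p c (visitInd (k + 1) v) ≤
      ∑ s ∈ Finset.range T, marginal G (s + 1) p c (ind {v}) * B (T - 1 - s) := by
  induction T generalizing p c with
  | zero => simp [expect, visitInd]
  | succ T ih =>
    rw [← sum_stepProb_mul_add_sum_marginal]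
    refine sum_stepProb_mul_le hd hG hp fun x hx => ?_
    have hsum : 0 ≤ ∑ s ∈ Finset.range T,
        marginal G (s + 1) (some c) x (ind {v}) * B (T - 1 - s) :=
      Finset.sum_nonneg fun s _ => mul_nonneg (marginal_nonneg hd hG hx (ind_nonneg _)) (hB0 _)
    -- A first step to `v` leaves `k` visits to make in `T` steps. The other terms of the sum are
    -- then dropped as nonnegative.
    by_cases hxv : x = v
    · subst hxv
      have : (fun l => visitInd (k + 1) x (x :: l)) = visitInd k x := by
        funext l; simp [visitInd]
      rw [this]
      have := hB T _ hx
      simp only [ind, Finset.mem_singleton, if_true, one_mul]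
      linarith
    · have : (fun l => visitInd (k + 1) v (x :: l)) = visitInd (k + 1) v := by
        funext l; simp [visitInd, hxv]
      rw [this]
      simpa [ind, hxv] using ih hx

/-- After the first visit, more visits are less likely by a bound that grows with time. -/
lemma expect_visitInd_succ_le_of_monotone (hd : 3 ≤ d) (hG : G.IsRegularOfDegree d) {k : ℕ} {v : V}
    {B : ℕ → ℝ} (hB0 : ∀ T, 0 ≤ B T) (hmono : Monotone B)
    (hB : ∀ T p, Adm G p v → expect G T p v (visitInd k v) ≤ B T) (T : ℕ) {p : Option V} {c : V}
    (hp : Adm G p c) : expect G T p c (visitInd (k + 1) v) ≤ B T := by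
  induction T generalizing p c with
  | zero => simpa [expect, visitInd] using hB0 0
  | succ T ih =>
    rw [← sum_stepProb_mul_const (G := G) p c (B (T + 1))]
    refine sum_stepProb_mul_le hd hG hp fun x hx => (le_trans ?_ (hmono T.le_succ))
    by_cases hxv : x = v
    · subst hxv
      have : (fun l => visitInd (k + 1) x (x :: l)) = visitInd k x := by
        funext l; simp [visitInd]
      rw [this]
      exact hB T _ hx
    · have : (fun l => visitInd (k + 1) v (x :: l)) = visitInd (k + 1) v := by
        funext l; simp [visitInd, hxv]
      rw [this]
      exact ih hx

/-- The first two terms of the binomial expansion. -/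
lemma pow_succ_add_mul_le {a b : ℝ} (ha : 0 ≤ a) (hb : 0 ≤ b) (k : ℕ) :
    a ^ (k + 1) + (k + 1) * b * a ^ k ≤ (a + b) ^ (k + 1) := by
  induction k with
  | zero => simp
  | succ k ih =>
    have h1 := mul_le_mul_of_nonneg_right ih (by linarith : 0 ≤ a + b)
    have h2 : 0 ≤ (k + 1) * b * a ^ k * b := by positivity
    rw [pow_succ (a + b) (k + 1)]
    push_cast
    calc a ^ (k + 1 + 1) + (k + 1 + 1) * b * a ^ (k + 1)
        ≤ (a ^ (k + 1) + (k + 1) * b * a ^ k) * (a + b) := by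
          rw [show (a ^ (k + 1) + (k + 1) * b * a ^ k) * (a + b) =
            a ^ (k + 1 + 1) + (k + 1 + 1) * b * a ^ (k + 1) + (k + 1) * b * a ^ k * b by ring]
          linarith
      _ ≤ _ := h1

/-- A left Riemann sum of an increasing function is at most its integral. -/
lemma sum_mul_pow_le {a y : ℝ} (ha : 0 ≤ a) (hy : 0 ≤ y) (k T : ℕ) :
    ∑ u ∈ Finset.range T, (k + 1) * a * (a * u + y) ^ k ≤ (a * T + y) ^ (k + 1) := by
  induction T with
  | zero => simp; positivity
  | succ T ih =>
    rw [Finset.sum_range_succ]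
    have h := pow_succ_add_mul_le (a := a * T + y) (b := a) (by positivity) ha k
    have e : a * ((T + 1 : ℕ) : ℝ) + y = a * T + y + a := by push_cast; ring
    rw [e]
    linarith

lemma sum_range_ite_le {B : ℝ} (hB : 0 ≤ B) (T τ : ℕ) :
    ∑ s ∈ Finset.range T, (if s < τ then B else 0) ≤ τ * B := by
  rw [← Finset.sum_filter, Finset.sum_const, nsmul_eq_mul]
  refine mul_le_mul_of_nonneg_right ?_ hB
  have : (Finset.range T).filter (· < τ) ⊆ Finset.range τ := by
    intro s hs
    simp only [Finset.mem_filter, Finset.mem_range] at hs ⊢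
    exact hs.2
  exact_mod_cast (Finset.card_le_card this).trans_eq (Finset.card_range τ)

namespace RapidMixing

variable {n τ : ℕ} {q : ℝ} (h : RapidMixing G d n τ q)

include h

lemma marginal_return_le {p : Option V} {x : V} (hp : Adm G p x) (s : ℕ) :
    marginal G (s + 1) p x (ind {x}) ≤ 2 / n + if s < τ then q else 0 := by
  have hn : (1 : ℝ) ≤ n := by exact_mod_cast h.pos
  split_ifs with hs
  · have := h.return_le p x hp (s + 1) (by omega)
    have : (0 : ℝ) ≤ 2 / n := by positivity
    linarith
  · have h1 := (abs_le.1 (h.mix p x hp {x} (s + 1) (by omega))).2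
    have h2 : 1 / (n : ℝ) ^ 2 ≤ 1 / n := by
      apply one_div_le_one_div_of_le (by linarith)
      nlinarith
    rw [Finset.card_singleton, Nat.cast_one] at h1
    have : (2 : ℝ) / n = 1 / n + 1 / n := by ring
    linarith

/-- The number of returns has factorially decaying tails. -/
lemma expect_visitInd_le (k : ℕ) {v : V} {p : Option V} (hp : Adm G p v) (T : ℕ) :
    expect G T p v (visitInd k v) ≤ (2 / n * T + k * (τ * q)) ^ k / k.factorial := by
  have hq := h.nonneg
  set a : ℝ := 2 / n with ha
  have ha0 : 0 ≤ a := by positivity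
  set η : ℝ := τ * q with hη
  have hη0 : 0 ≤ η := by positivity
  induction k generalizing p T with
  | zero =>
    have h0 : visitInd 0 v = fun _ => (1 : ℝ) := by funext l; simp [visitInd]
    simp [h0, expect_const]
  | succ k ih =>
    -- One more return convolves the bound with 2/n + q·1(s < τ). The constant part integrates the
    -- power of time and produces the factorial; the short-time part is absorbed by adding one more
    -- η to the base.
    set y : ℝ := k * η with hy
    have hy0 : 0 ≤ y := by positivity
    set B : ℕ → ℝ := fun T => (a * T + y) ^ k / k.factorial with hB
    have hB0 : ∀ T, 0 ≤ B T := fun T => by positivity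
    have hBmono : Monotone B := fun T T' hT => by
      simp only [hB]
      gcongr
    have h1 := expect_visitInd_succ_le h.three_le h.regular hB0 (fun T p hp => ih hp T) T hp
    have h2 : ∑ s ∈ Finset.range T, marginal G (s + 1) p v (ind {v}) * B (T - 1 - s) ≤
        a * ∑ u ∈ Finset.range T, B u + η * B T := by
      calc ∑ s ∈ Finset.range T, marginal G (s + 1) p v (ind {v}) * B (T - 1 - s)
          ≤ ∑ s ∈ Finset.range T, (a * B (T - 1 - s) + (if s < τ then q else 0) * B T) := by
            refine Finset.sum_le_sum fun s _ => ?_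
            have h3 := mul_le_mul_of_nonneg_right (h.marginal_return_le hp s) (hB0 (T - 1 - s))
            have h4 : (if s < τ then q else 0) * B (T - 1 - s) ≤
                (if s < τ then q else 0) * B T := by
              refine mul_le_mul_of_nonneg_left (hBmono (by omega)) ?_
              split_ifs <;> [exact hq; exact le_rfl]
            linarith
        _ ≤ _ := by
            rw [Finset.sum_add_distrib, ← Finset.mul_sum, ← Finset.sum_mul,
              Finset.sum_range_reflect]
            exact add_le_add le_rfl
              (mul_le_mul_of_nonneg_right (sum_range_ite_le hq T τ) (hB0 T))
    have h5 := sum_mul_pow_le ha0 hy0 k T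
    have h6 := pow_succ_add_mul_le (a := a * T + y) (b := η) (by positivity) hη0 k
    have e1 : a * T + ((k + 1 : ℕ) : ℝ) * η = a * T + y + η := by push_cast; ring
    have hfac : (0 : ℝ) < (k + 1).factorial := by positivity
    rw [e1]
    refine (h1.trans h2).trans ?_
    rw [le_div_iff₀ hfac]
    have e2 : (a * ∑ u ∈ Finset.range T, B u + η * B T) * ((k + 1).factorial : ℝ) =
        ∑ u ∈ Finset.range T, (k + 1) * a * (a * u + y) ^ k + (k + 1) * η * (a * T + y) ^ k := by
      simp only [hB, ← Finset.sum_div, ← Finset.mul_sum, Nat.factorial_succ]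
      push_cast
      field_simp
    rw [e2]
    linarith

/-- An upper tail bound for the maximal number of visits. -/
lemma expect_maxVisits_ge_le (k T : ℕ) {p : Option V} {c : V} (hp : Adm G p c) :
    expect G T p c (fun l => if k + 1 ≤ maxVisits l then 1 else 0) ≤
      n * ((2 / n * T + k * (τ * q)) ^ k / k.factorial) := by
  have hq := h.nonneg
  have h1 : expect G T p c (fun l => if k + 1 ≤ maxVisits l then 1 else 0) ≤
      expect G T p c (fun l => ∑ v, visitInd (k + 1) v l) := by
    refine expect_mono h.three_le h.regular hp fun l _ _ => ?_
    split_ifs with hl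
    · obtain ⟨v, hv⟩ : ∃ v, k + 1 ≤ l.count v := by
        by_contra hcon
        push Not at hcon
        have : maxVisits l ≤ k := Finset.sup_le fun v _ => Nat.lt_succ_iff.1 (hcon v)
        omega
      refine le_trans ?_ (Finset.single_le_sum (fun v _ => visitInd_nonneg _ v l)
        (Finset.mem_univ v))
      simp [visitInd, hv]
    · exact Finset.sum_nonneg fun v _ => visitInd_nonneg _ _ _
  refine h1.trans ?_
  rw [expect_sum, ← h.card_eq, ← Finset.card_univ, ← nsmul_eq_mul, ← Finset.sum_const]
  rw [Finset.card_univ, h.card_eq]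
  refine Finset.sum_le_sum fun v _ => ?_
  -- The first visit is granted for free; only the `k` later returns are charged.
  refine expect_visitInd_succ_le_of_monotone h.three_le h.regular
    (B := fun T : ℕ => (2 / n * T + k * (τ * q)) ^ k / k.factorial) (fun T => by positivity) ?_
    (fun T p hp => h.expect_visitInd_le k hp T) T hp
  intro T T' hT
  simp only
  gcongr

end RapidMixing

end NonBacktracking

/-! ### The lower tail: a second moment argument in successive periods. -/

namespace NonBacktracking

universe u

variable {V : Type u} [Fintype V] [DecidableEq V] {G : SimpleGraph V} [DecidableRel G.Adj]
variable {d : ℕ}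

/-- The number of positions in `W`, with multiplicity. -/
noncomputable def hits (W : Finset V) : List V → ℝ
  | [] => 0
  | x :: l => ind W x + hits W l

/-- The number of positions in `W` that are visited again later. -/
noncomputable def repeats (W : Finset V) : List V → ℝ
  | [] => 0
  | x :: l => ind W x * visitInd 1 x l + repeats W l

lemma repeats_nonneg (W : Finset V) (l : List V) : 0 ≤ repeats W l := by
  induction l with
  | nil => exact le_rfl
  | cons x l ih =>
    exact add_nonneg (mul_nonneg (ind_nonneg _ _) (visitInd_nonneg _ _ _)) ih

/-- Each visited vertex of `W` is counted once, at its last occurrence. -/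
lemma hits_sub_repeats (W : Finset V) (l : List V) :
    hits W l - repeats W l = (W.filter (· ∈ l)).card := by
  induction l with
  | nil => simp [hits, repeats]
  | cons x l ih =>
    have e : hits W (x :: l) - repeats W (x :: l) =
        (hits W l - repeats W l) + ind W x * (1 - visitInd 1 x l) := by
      simp only [hits, repeats]; ring
    rw [e, ih]
    by_cases hx : x ∈ W
    · by_cases hl : x ∈ l
      · have h1 : W.filter (· ∈ x :: l) = W.filter (· ∈ l) := by
          ext y
          simp only [Finset.mem_filter, List.mem_cons]
          constructor
          · rintro ⟨h, rfl | h'⟩ <;> exact ⟨h, by assumption⟩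
          · exact fun h => ⟨h.1, Or.inr h.2⟩
        have h2 : visitInd 1 x l = 1 := by simp [visitInd, List.one_le_count_iff, hl]
        rw [h1, h2]; ring
      · have h1 : W.filter (· ∈ x :: l) = insert x (W.filter (· ∈ l)) := by
          ext y
          simp only [Finset.mem_filter, List.mem_cons, Finset.mem_insert]
          constructor
          · rintro ⟨h, h' | h'⟩
            · exact Or.inl h'
            · exact Or.inr ⟨h, h'⟩
          · rintro (h | h)
            · exact ⟨h ▸ hx, Or.inl h⟩
            · exact ⟨h.1, Or.inr h.2⟩
        have h2 : visitInd 1 x l = 0 := by simp [visitInd, hl]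
        rw [h1, h2, Finset.card_insert_of_notMem (by simp [hl])]
        simp [ind, hx]
    · have h1 : W.filter (· ∈ x :: l) = W.filter (· ∈ l) := by
        ext y
        simp only [Finset.mem_filter, List.mem_cons]
        constructor
        · rintro ⟨h, rfl | h'⟩
          · exact absurd h hx
          · exact ⟨h, h'⟩
        · exact fun h => ⟨h.1, Or.inr h.2⟩
      rw [h1]
      simp [ind, hx]

lemma ind_mul_self (W : Finset V) (x : V) : ind W x * ind W x = ind W x := by
  unfold ind; split_ifs <;> simp

lemma expect_hits (W : Finset V) (T : ℕ) (p : Option V) (c : V) :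
    expect G T p c (hits W) = ∑ s ∈ Finset.range T, marginal G (s + 1) p c (ind W) := by
  induction T generalizing p c with
  | zero => simp [expect, hits]
  | succ T ih =>
    have := sum_stepProb_mul_add_sum_marginal (G := G) (ind W) (fun _ => 1) T p c
    simp only [mul_one] at this
    rw [← this]
    refine Finset.sum_congr rfl fun x _ => ?_
    simp only [hits]
    rw [expect_add, expect_const, ih]

namespace RapidMixing

variable {n τ : ℕ} {q : ℝ} (h : RapidMixing G d n τ q)

include h

lemma marginal_ind_le {p : Option V} {c : V} (hp : Adm G p c) (W : Finset V) (s : ℕ) :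
    marginal G (s + 1) p c (ind W) ≤
      ((W.card : ℝ) / n + 1 / (n : ℝ) ^ 2) + if s < τ then 1 else 0 := by
  split_ifs with hs
  · have h1 : marginal G (s + 1) p c (ind W) ≤ 1 := by
      rw [← marginal_const (G := G) (s + 1) p c (1 : ℝ)]
      exact marginal_mono h.three_le h.regular hp (ind_le_one W)
    have : (0 : ℝ) ≤ (W.card : ℝ) / n + 1 / (n : ℝ) ^ 2 := by positivity
    linarith
  · have h1 := (abs_le.1 (h.mix p c hp W (s + 1) (by omega))).2
    linarith

lemma le_marginal_ind {p : Option V} {c : V} (hp : Adm G p c) (W : Finset V) (s : ℕ) :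
    ((W.card : ℝ) / n - 1 / (n : ℝ) ^ 2) - (if s < τ then 1 else 0) ≤
      marginal G (s + 1) p c (ind W) := by
  have hn : (0 : ℝ) < n := by exact_mod_cast h.pos
  split_ifs with hs
  · have h1 := marginal_nonneg h.three_le h.regular hp (ind_nonneg W) (k := s + 1)
    have h2 : (W.card : ℝ) / n ≤ 1 := by
      rw [div_le_one hn]
      exact_mod_cast W.card_le_univ.trans_eq h.card_eq
    have : (0 : ℝ) ≤ 1 / (n : ℝ) ^ 2 := by positivity
    linarith
  · have h1 := (abs_le.1 (h.mix p c hp W (s + 1) (by omega))).1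
    linarith

lemma expect_hits_le {p : Option V} {c : V} (hp : Adm G p c) (W : Finset V) (T : ℕ) :
    expect G T p c (hits W) ≤ ((W.card : ℝ) / n + 1 / (n : ℝ) ^ 2) * T + τ := by
  rw [expect_hits]
  refine (Finset.sum_le_sum fun s _ => h.marginal_ind_le hp W s).trans ?_
  rw [Finset.sum_add_distrib, Finset.sum_const, Finset.card_range, nsmul_eq_mul]
  have := sum_range_ite_le (zero_le_one' ℝ) T τ
  linarith

lemma le_expect_hits {p : Option V} {c : V} (hp : Adm G p c) (W : Finset V) (T : ℕ) :
    ((W.card : ℝ) / n - 1 / (n : ℝ) ^ 2) * T - τ ≤ expect G T p c (hits W) := by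
  rw [expect_hits]
  refine le_trans ?_ (Finset.sum_le_sum fun s _ => h.le_marginal_ind hp W s)
  rw [Finset.sum_sub_distrib, Finset.sum_const, Finset.card_range, nsmul_eq_mul]
  have := sum_range_ite_le (zero_le_one' ℝ) T τ
  linarith

/-- Expanding the square one position at a time, each hit contributes 1 plus twice the number of
later hits, whose conditional mean is bounded by `expect_hits_le`. -/
lemma expect_hits_sq_le {p : Option V} {c : V} (hp : Adm G p c) (W : Finset V) (T : ℕ) {ρ : ℝ}
    (hρ : ρ = (W.card : ℝ) / n + 1 / (n : ℝ) ^ 2) :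
    expect G T p c (fun l => hits W l ^ 2) ≤
      (1 + 2 * τ) * (ρ * T + τ) + ρ ^ 2 * T ^ 2 + 2 * τ * (ρ * T) := by
  have hρ0 : 0 ≤ ρ := by rw [hρ]; positivity
  set B : ℕ → ℝ := fun u => 1 + 2 * (ρ * u + τ) with hB
  have hB0 : ∀ u, 0 ≤ B u := fun u => by positivity
  have h1 : ∀ T p c, Adm G p c → expect G T p c (fun l => hits W l ^ 2) ≤
      ∑ s ∈ Finset.range T, marginal G (s + 1) p c (ind W) * B (T - 1 - s) := by
    intro T
    induction T with
    | zero => intro p c _; simp [expect, hits]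
    | succ T ih =>
      intro p c hp
      rw [← sum_stepProb_mul_add_sum_marginal]
      refine sum_stepProb_mul_le h.three_le h.regular hp fun x hx => ?_
      have e : (fun l => hits W (x :: l) ^ 2) =
          fun l => (ind W x + 2 * ind W x * hits W l) + hits W l ^ 2 := by
        funext l
        simp only [hits]
        linear_combination ind_mul_self W x
      rw [e, expect_add, expect_add, expect_const, expect_const_mul]
      have h2 := mul_le_mul_of_nonneg_left (h.expect_hits_le hx W T)
        (mul_nonneg zero_le_two (ind_nonneg W x))
      have h3 := ih (some c) x hx
      have h4 : ind W x * B T = ind W x + 2 * ind W x * (ρ * T + τ) := by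
        simp only [hB]; ring
      rw [← hρ] at h2
      linarith
  refine (h1 T p c hp).trans ?_
  have h2 : ∑ s ∈ Finset.range T, marginal G (s + 1) p c (ind W) * B (T - 1 - s) ≤
      ρ * ∑ u ∈ Finset.range T, B u + τ * B T := by
    calc ∑ s ∈ Finset.range T, marginal G (s + 1) p c (ind W) * B (T - 1 - s)
        ≤ ∑ s ∈ Finset.range T, (ρ * B (T - 1 - s) + if s < τ then B T else 0) := by
          refine Finset.sum_le_sum fun s _ => ?_
          have h3 := mul_le_mul_of_nonneg_right (h.marginal_ind_le hp W s) (hB0 (T - 1 - s))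
          rw [← hρ] at h3
          have h4 : (if s < τ then 1 else 0) * B (T - 1 - s) ≤ if s < τ then B T else 0 := by
            split_ifs
            · rw [one_mul]
              simp only [hB]
              have : ((T - 1 - s : ℕ) : ℝ) ≤ T := by exact_mod_cast (by omega)
              gcongr
            · simp
          linarith
      _ ≤ _ := by
          rw [Finset.sum_add_distrib, ← Finset.mul_sum, Finset.sum_range_reflect]
          exact add_le_add le_rfl (sum_range_ite_le (hB0 T) T τ)
  refine h2.trans ?_
  have h3 : ∑ u ∈ Finset.range T, B u ≤ (1 + 2 * τ) * T + ρ * T ^ 2 := by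
    have h4 : ∀ T : ℕ, ∑ u ∈ Finset.range T, B u = (1 + 2 * τ) * T + ρ * (T * (T - 1)) := by
      intro T
      induction T with
      | zero => simp
      | succ T ih => rw [Finset.sum_range_succ, ih]; simp only [hB]; push_cast; ring
    rw [h4]
    have : (T : ℝ) * (T - 1) ≤ T ^ 2 := by nlinarith [(Nat.cast_nonneg T : (0 : ℝ) ≤ T)]
    have := mul_le_mul_of_nonneg_left this hρ0
    linarith
  have h5 := mul_le_mul_of_nonneg_left h3 hρ0
  have h6 : τ * B T = τ * (1 + 2 * τ) + 2 * τ * (ρ * T) := by simp only [hB]; ring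
  rw [h6]
  nlinarith

/-- Given a hit, `expect_visitInd_le` for a single return bounds the probability that the same
vertex is seen again. -/
lemma expect_repeats_le {p : Option V} {c : V} (hp : Adm G p c) (W : Finset V) (T : ℕ) :
    expect G T p c (repeats W) ≤ (2 / n * T + τ * q) * expect G T p c (hits W) := by
  have hq := h.nonneg
  set Q : ℝ := 2 / n * T + τ * q with hQ
  have hQ0 : 0 ≤ Q := by positivity
  have key : ∀ T' ≤ T, ∀ p c, Adm G p c →
      expect G T' p c (repeats W) ≤ Q * expect G T' p c (hits W) := by
    intro T'
    induction T' with
    | zero => intro _ p c _; simp [expect, hits, repeats]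
    | succ T' ih =>
      intro hT p c hp
      simp only [expect]
      rw [Finset.mul_sum]
      simp only [mul_left_comm Q]
      refine sum_stepProb_mul_le h.three_le h.regular hp fun x hx => ?_
      simp only [repeats, hits]
      rw [expect_add, expect_add, expect_const, expect_const_mul]
      have h1 := h.expect_visitInd_le 1 hx T'
      simp only [pow_one, Nat.factorial_one, Nat.cast_one, div_one, one_mul] at h1
      have h2 : expect G T' (some c) x (visitInd 1 x) ≤ Q := by
        refine h1.trans ?_
        have : (T' : ℝ) ≤ T := by exact_mod_cast (by omega)
        rw [hQ]
        gcongr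
      have h3 := mul_le_mul_of_nonneg_left h2 (ind_nonneg W x)
      have h4 := ih (by omega) (some c) x hx
      linarith
  exact key T le_rfl p c hp

/-- In a period of length `T` the walk visits many different points of a given set. -/
lemma expect_few_distinct_le {p : Option V} {c : V} (hp : Adm G p c) (W : Finset V) {T : ℕ}
    (hT : T ≤ n) {μ : ℝ} (hμ : μ = T * W.card / n) (hτ : τ ≤ μ) :
    expect G T p c (fun l => if μ / 4 ≤ ((W.filter (· ∈ l)).card : ℝ) then 0 else 1) ≤
      80 * τ / μ + 12 * (2 / n * T + τ * q) := by
  have hq := h.nonneg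
  have hn : (1 : ℝ) ≤ n := by exact_mod_cast h.pos
  have hτ1 : (1 : ℝ) ≤ τ := by exact_mod_cast h.one_le_time
  have hμ0 : 0 < μ := by linarith
  have hTn : (T : ℝ) ≤ n := by exact_mod_cast hT
  set Q : ℝ := 2 / n * T + τ * q with hQ
  have hQ0 : 0 ≤ Q := by positivity
  set S := expect G T p c (hits W) with hS
  have hε : (T : ℝ) / n ^ 2 ≤ 1 := by
    rw [div_le_one (by positivity)]
    nlinarith
  have hS1 : S ≤ μ + 1 + τ := by
    have := h.expect_hits_le hp W T
    have e : ((W.card : ℝ) / n + 1 / (n : ℝ) ^ 2) * T + τ = μ + T / n ^ 2 + τ := by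
      rw [hμ]; ring
    linarith
  have hS2 : μ - 1 - τ ≤ S := by
    have := h.le_expect_hits hp W T
    have e : ((W.card : ℝ) / n - 1 / (n : ℝ) ^ 2) * T - τ = μ - T / n ^ 2 - τ := by
      rw [hμ]; ring
    linarith
  have hSS : expect G T p c (fun l => hits W l ^ 2) ≤
      (1 + 2 * τ) * (μ + 1 + τ) + (μ + 1) ^ 2 + 2 * τ * (μ + 1) := by
    refine (h.expect_hits_sq_le hp W T rfl).trans ?_
    have e : ((W.card : ℝ) / n + 1 / (n : ℝ) ^ 2) * T ≤ μ + 1 := by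
      have e : ((W.card : ℝ) / n + 1 / (n : ℝ) ^ 2) * T = μ + T / n ^ 2 := by
        rw [hμ]; ring
      linarith
    have e0 : 0 ≤ ((W.card : ℝ) / n + 1 / (n : ℝ) ^ 2) * T := by positivity
    rw [← mul_pow]
    gcongr
  have hR : expect G T p c (repeats W) ≤ Q * (3 * μ) := by
    refine (h.expect_repeats_le hp W T).trans (mul_le_mul_of_nonneg_left ?_ hQ0)
    linarith
  -- Fewer than μ/4 distinct points force more than μ/4 repeats or fewer than μ/2 hits. Markov's
  -- inequality handles the former, a second moment around μ the latter.
  have hpt : ∀ l : List V, (if μ / 4 ≤ ((W.filter (· ∈ l)).card : ℝ) then (0 : ℝ) else 1) ≤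
      ((4 / μ ^ 2) * hits W l ^ 2 + (-8 / μ) * hits W l + 4) + (4 / μ) * repeats W l := by
    intro l
    have hr := repeats_nonneg W l
    have e : (4 / μ ^ 2) * hits W l ^ 2 + (-8 / μ) * hits W l + 4 =
        (2 * (hits W l - μ) / μ) ^ 2 := by field_simp; ring
    rw [e]
    split_ifs with hl
    · positivity
    · rw [← hits_sub_repeats, not_le] at hl
      by_cases hR : μ / 4 < repeats W l
      · have h1 : 1 ≤ 4 / μ * repeats W l := by
          rw [div_mul_eq_mul_div, le_div_iff₀ hμ0]; linarith
        have := sq_nonneg (2 * (hits W l - μ) / μ)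
        linarith
      · have h1 : 1 ≤ (2 * (hits W l - μ) / μ) ^ 2 := by
          rw [← sq_abs, abs_div, abs_of_pos hμ0, div_pow, le_div_iff₀ (by positivity), one_mul]
          refine pow_le_pow_left₀ hμ0.le ?_ 2
          rw [le_abs]
          right
          linarith
        have : 0 ≤ 4 / μ * repeats W l := by positivity
        linarith
  have hmain := expect_mono h.three_le h.regular hp (k := T) fun l _ _ => hpt l
  rw [expect_add, expect_add, expect_add, expect_const, expect_const_mul, expect_const_mul,
    expect_const_mul, ← hS] at hmain
  refine hmain.trans ?_
  have h1 : 4 / μ * expect G T p c (repeats W) ≤ 12 * Q := by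
    refine (mul_le_mul_of_nonneg_left hR (by positivity)).trans_eq ?_
    field_simp
    ring
  have h2 : 4 / μ ^ 2 * expect G T p c (fun l => hits W l ^ 2) + -8 / μ * S + 4 ≤ 80 * τ / μ := by
    -- As 1 ≤ τ ≤ μ, each error term is at most a multiple of τμ; the multiples 9, 3, 4 and 4 add up
    -- to 20.
    have h3 : expect G T p c (fun l => hits W l ^ 2) - 2 * μ * S + μ ^ 2 ≤ 20 * τ * μ := by
      nlinarith
    have e : 4 / μ ^ 2 * expect G T p c (fun l => hits W l ^ 2) + -8 / μ * S + 4 =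
        (expect G T p c (fun l => hits W l ^ 2) - 2 * μ * S + μ ^ 2) * (4 / μ ^ 2) := by
      field_simp; ring
    rw [e]
    refine (mul_le_mul_of_nonneg_right h3 (by positivity)).trans_eq ?_
    field_simp
    ring
  linarith

/-- With high probability there are many vertices with at least `j` visits after `j` periods. -/
lemma expect_few_popular_le {c : V} {T k : ℕ} (hT : T ≤ n) {θ : ℝ}
    (hθ : θ = T / (4 * n)) (hk : τ ≤ 4 * (n * θ ^ k)) (j : ℕ) (hj : j ≤ k) :
    expect G (j * T) none c (fun l =>
      if n * θ ^ j ≤ ((Finset.univ.filter fun v => j ≤ l.count v).card : ℝ) then 0 else 1) ≤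
      j * (20 * τ / (n * θ ^ k) + 12 * (2 / n * T + τ * q)) := by
  have hq := h.nonneg
  have hn : (1 : ℝ) ≤ n := by exact_mod_cast h.pos
  have hτ1 : (1 : ℝ) ≤ τ := by exact_mod_cast h.one_le_time
  have hTn : (T : ℝ) ≤ n := by exact_mod_cast hT
  have hθ0 : 0 ≤ θ := by rw [hθ]; positivity
  have hθ1 : θ ≤ 1 := by
    rw [hθ, div_le_one (by linarith)]; linarith
  have hpos : 0 < n * θ ^ k := by linarith
  set δ : ℝ := 20 * τ / (n * θ ^ k) + 12 * (2 / n * T + τ * q) with hδ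
  induction j with
  | zero => simp [expect, h.card_eq]
  | succ j ih =>
    have ih := ih (by omega)
    -- Condition on the first `j` periods. They determine the set `W` below; if it is large, the
    -- next period fails to meet enough of it with probability at most `δ`.
    rw [Nat.succ_mul, expect_append]
    push_cast
    have e : ((j : ℝ) + 1) * δ = j * δ + expect G (j * T) none c (fun _ => δ) := by
      rw [expect_const]; ring
    rw [e]
    refine le_trans ?_ (add_le_add_left ih _)
    rw [← expect_add]
    refine expect_mono h.three_le h.regular (adm_none c) fun l _ hl => ?_
    set W : Finset V := Finset.univ.filter fun v => j ≤ l.count v with hW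
    by_cases hc : n * θ ^ j ≤ (W.card : ℝ)
    · rw [if_pos hc, zero_add]
      set μ : ℝ := T * W.card / n with hμ
      have hμθ : μ / 4 = θ * W.card := by rw [hμ, hθ]; field_simp
      have h1 : n * θ ^ (j + 1) ≤ μ / 4 := by
        rw [hμθ, pow_succ]
        have := mul_le_mul_of_nonneg_left hc hθ0
        linarith
      have h2 : n * θ ^ k ≤ n * θ ^ (j + 1) :=
        mul_le_mul_of_nonneg_left (pow_le_pow_of_le_one hθ0 hθ1 hj) (by linarith)
      have h3 := h.expect_few_distinct_le hl W hT hμ (by linarith)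
      refine (expect_mono h.three_le h.regular hl fun l' _ _ => ?_).trans (h3.trans ?_)
      · by_cases h5 : μ / 4 ≤ ((W.filter (· ∈ l')).card : ℝ)
        swap
        · rw [if_neg h5]
          split_ifs <;> norm_num
        rw [if_pos h5, if_pos]
        refine h1.trans (h5.trans ?_)
        have hsub : W.filter (· ∈ l') ⊆
            Finset.univ.filter fun v => j + 1 ≤ (l ++ l').count v := by
          intro v hv
          rw [Finset.mem_filter] at hv
          have h6 : j ≤ l.count v := (Finset.mem_filter.1 hv.1).2
          have h7 : 1 ≤ l'.count v := List.one_le_count_iff.2 hv.2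
          rw [Finset.mem_filter, List.count_append]
          exact ⟨Finset.mem_univ v, by omega⟩
        exact_mod_cast Finset.card_le_card hsub
      · have h4 : 80 * τ / μ ≤ 20 * τ / (n * θ ^ k) := by
          have : 4 * (n * θ ^ k) ≤ μ := by linarith
          calc 80 * (τ : ℝ) / μ ≤ 80 * τ / (4 * (n * θ ^ k)) := by gcongr
            _ = _ := by field_simp; ring
        linarith
    · rw [if_neg hc]
      have h1 : expect G T (advance none c l).1 (advance none c l).2 (fun l' =>
          if n * θ ^ (j + 1) ≤
            ((Finset.univ.filter fun v => j + 1 ≤ (l ++ l').count v).card : ℝ) then 0 else 1) ≤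
          1 := by
        refine (expect_mono h.three_le h.regular hl fun l' _ _ => ?_).trans_eq
          (expect_const (G := G) T (advance none c l).1 (advance none c l).2 (1 : ℝ))
        split_ifs <;> norm_num
      have : 0 ≤ δ := by positivity
      linarith

/-- A lower tail bound for the maximal number of visits. -/
lemma expect_maxVisits_lt_le {c : V} {T k : ℕ} (hkT : k * T ≤ n) (hT : T ≤ n) {θ : ℝ}
    (hθ : θ = T / (4 * n)) (hk : τ ≤ 4 * (n * θ ^ k)) :
    expect G n none c (fun l => if k ≤ maxVisits l then 0 else 1) ≤
      k * (20 * τ / (n * θ ^ k) + 12 * (2 / n * T + τ * q)) := by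
  have hτ1 : (1 : ℝ) ≤ τ := by exact_mod_cast h.one_le_time
  refine le_trans ?_ (h.expect_few_popular_le hT hθ hk k le_rfl (c := c))
  -- The steps left over after `k` periods can only add visits.
  have e : expect G n none c (fun l => if k ≤ maxVisits l then (0 : ℝ) else 1) =
      expect G (k * T + (n - k * T)) none c (fun l => if k ≤ maxVisits l then 0 else 1) := by
    rw [Nat.add_sub_cancel' hkT]
  rw [e, expect_append]
  refine expect_mono h.three_le h.regular (adm_none c) fun l _ hl => ?_
  rw [← expect_const (G := G) (n - k * T) (advance none c l).1 (advance none c l).2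
    (if n * θ ^ k ≤ ((Finset.univ.filter fun v => k ≤ l.count v).card : ℝ) then (0 : ℝ) else 1)]
  refine expect_mono h.three_le h.regular hl fun l' _ _ => ?_
  split_ifs with h1 h2 <;> try norm_num
  have h3 : 0 < ((Finset.univ.filter fun v => k ≤ l.count v).card : ℝ) := by linarith
  obtain ⟨v, hv⟩ := Finset.card_pos.1 (Nat.cast_pos.1 h3)
  refine h1 (((Finset.mem_filter.1 hv).2.trans ?_).trans
    (Finset.le_sup (f := fun v => (l ++ l').count v) (Finset.mem_univ v)))
  rw [List.count_append]
  omega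

end RapidMixing

end NonBacktracking

/-! ### Asymptotics of the two levels, and verification of `RapidMixing`. -/

namespace NonBacktracking

section Asymptotics

variable {L l t δ : ℝ}

/-- In the application L, l, t are log n, log log n, log log log n. The right side bounds
log(j!/3^j) from below at the upper level `j`: log j ≥ l − t − 1, and 3 more per factor pay for
Stirling and for 3^j. The surplus δt in the product beats the constants and the term of order t²/l.
-/
lemma upper_level_le (hδ0 : 0 < δ) (hδ1 : δ ≤ 1) (ht : 8 ≤ δ * t) (htl : 16 * t ≤ δ * l)
    (hlL : 8 * l ^ 2 ≤ δ * L) :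
    L + δ / 8 * (L / l) ≤ ((1 + (1 + δ) * (t / l)) * (L / l) - 1) * (l - t - 4) := by
  have ht0 : 8 ≤ t := by nlinarith
  have hl0 : 0 < l := by nlinarith
  have hL0 : 0 < L := by nlinarith [sq_nonneg l, pow_pos hl0 2]
  have hz : 0 < L / l := by positivity
  have hlz : l ≤ δ / 8 * (L / l) := by
    rw [div_mul_div_comm, le_div_iff₀ (by positivity)]
    nlinarith
  have h1 : (1 + (1 + δ) * (t / l)) * (l - t - 4) ≥ l + δ / 4 * t := by
    have e : (1 + (1 + δ) * (t / l)) * (l - t - 4) =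
        l + (δ * t - 4) - (1 + δ) * t * ((t + 4) / l) := by field_simp; ring
    have h2 : (t + 4) / l ≤ δ / 8 := by
      rw [div_le_iff₀ hl0]; linarith
    have h3 : (1 + δ) * t * ((t + 4) / l) ≤ 2 * t * (δ / 8) := by gcongr; linarith
    rw [e]
    linarith
  have h2 := mul_le_mul_of_nonneg_right h1 hz.le
  have h3 : l * (L / l) = L := by field_simp
  have h4 : δ / 4 * 1 * (L / l) ≤ δ / 4 * t * (L / l) := by gcongr; linarith
  have e : ((1 + (1 + δ) * (t / l)) * (L / l) - 1) * (l - t - 4) =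
    (1 + (1 + δ) * (t / l)) * (l - t - 4) * (L / l) - l + t + 4 := by ring
  rw [e]
  linarith

/-- The two factors bound `k` and −log θ at the lower level. The margin 3l is what leaves L³
vertices in `cube_le_mul_pow`, enough to outweigh the factor kτ = O(L²) in the failure probability.
-/
lemma lower_level_le (hδ0 : 0 < δ) (hδ1 : δ ≤ 1) {b : ℝ} (ht : 8 ≤ δ * t) (htl : 16 * t ≤ δ * l)
    (htb : 2 * b ≤ δ * t) (hlL : 10 * l ^ 2 ≤ δ * L) :
    ((1 + (1 - δ) * (t / l)) * (L / l) + 1) * (l - t + b) + 3 * l ≤ L := by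
  have ht0 : 8 ≤ t := by nlinarith
  have hl0 : 0 < l := by nlinarith
  have hL0 : 0 < L := by nlinarith [sq_nonneg l, pow_pos hl0 2]
  have hz : 0 < L / l := by positivity
  have hbt : b ≤ t := by nlinarith
  have hlz : 5 * l ≤ δ / 2 * (L / l) := by
    rw [div_mul_div_comm, le_div_iff₀ (by positivity)]
    nlinarith
  have h1 : (1 + (1 - δ) * (t / l)) * (l - t + b) ≤ l - δ / 2 * t := by
    have e : (1 + (1 - δ) * (t / l)) * (l - t + b) =
        l - (δ * t - b) - (1 - δ) * (t / l) * (t - b) := by field_simp; ring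
    have h3 : 0 ≤ (1 - δ) * (t / l) * (t - b) := by
      have h4 : 0 ≤ 1 - δ := by linarith
      have h5 : 0 ≤ t - b := by linarith
      positivity
    rw [e]
    linarith
  have h2 := mul_le_mul_of_nonneg_right h1 hz.le
  have h3 : l * (L / l) = L := by field_simp
  have h4 : δ / 2 * 1 * (L / l) ≤ δ / 2 * t * (L / l) := by gcongr; linarith
  have e : ((1 + (1 - δ) * (t / l)) * (L / l) + 1) * (l - t + b) =
    (1 + (1 - δ) * (t / l)) * (l - t + b) * (L / l) + (l - t + b) := by ring
  rw [e]
  linarith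

/-- The first moment of the number of vertices with more visits than the upper level. -/
lemma exp_mul_pow_div_factorial_le (hl : l = Real.log L) (htdef : t = Real.log l)
    (hδ0 : 0 < δ) (hδ1 : δ ≤ 1) (ht : 8 ≤ δ * t) (htl : 16 * t ≤ δ * l)
    (hlL : 8 * l ^ 2 ≤ δ * L) {j : ℕ} (hj : j = ⌊(1 + (1 + δ) * (t / l)) * (L / l)⌋₊) {x : ℝ}
    (hx0 : 0 ≤ x) (hx : x ≤ 3) :
    Real.exp L * (x ^ j / j.factorial) ≤ Real.exp (-(δ / 8 * (L / l))) := by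
  have ht0 : 8 ≤ t := by nlinarith
  have hl0 : 128 ≤ l := by nlinarith
  have hL0 : 0 < L := by nlinarith [sq_nonneg l]
  have hz : 0 < L / l := by positivity
  have hz2 : 2 ≤ L / l := by
    rw [le_div_iff₀ (by linarith)]; nlinarith
  set a := (1 + (1 + δ) * (t / l)) * (L / l) with ha
  have haz : L / l ≤ a := by
    rw [ha]
    refine le_mul_of_one_le_left hz.le ?_
    have : 0 ≤ (1 + δ) * (t / l) := by positivity
    linarith
  have hja : a - 1 ≤ j := by
    rw [hj]; exact (Nat.sub_one_lt_floor a).le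
  have hj2 : L / l * (1 / 2) ≤ j := by linarith
  have hj0 : (0 : ℝ) < j := by linarith
  have hlogj : l - t - 1 ≤ Real.log j := by
    have h1 : Real.log (L / l * (1 / 2)) ≤ Real.log j := Real.log_le_log (by positivity) hj2
    rw [Real.log_mul hz.ne' (by norm_num), Real.log_div hL0.ne' (by linarith), ← hl, ← htdef,
      one_div, Real.log_inv] at h1
    have := Real.log_two_lt_d9
    linarith
  have hfac : x ^ j / j.factorial ≤ Real.exp (j * (3 - Real.log j)) := by
    have h1 : (j : ℝ) ^ j / j.factorial ≤ Real.exp j := Real.pow_div_factorial_le_exp _ hj0.le j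
    have h2 : x ^ j ≤ Real.exp (2 * j) := by
      have h3 : (3 : ℝ) ≤ Real.exp 2 := by
        have := Real.add_one_le_exp (2 : ℝ); linarith
      calc x ^ j ≤ (Real.exp 2) ^ j := pow_le_pow_left₀ hx0 (hx.trans h3) j
        _ = Real.exp (2 * j) := by rw [← Real.exp_nat_mul, mul_comm]
    have h4 : (j : ℝ) ^ j = Real.exp (j * Real.log j) := by
      rw [mul_comm, Real.exp_mul, Real.exp_log hj0, Real.rpow_natCast]
    have h5 : (1 : ℝ) / j.factorial ≤ Real.exp (j - j * Real.log j) := by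
      rw [Real.exp_sub, ← h4, le_div_iff₀ (by positivity)]
      calc 1 / (j.factorial : ℝ) * (j : ℝ) ^ j = (j : ℝ) ^ j / j.factorial := by ring
        _ ≤ _ := h1
    calc x ^ j / j.factorial = x ^ j * (1 / j.factorial) := by ring
      _ ≤ Real.exp (2 * j) * Real.exp (j - j * Real.log j) := by gcongr
      _ = _ := by rw [← Real.exp_add]; congr 1; ring
  have hmain := upper_level_le hδ0 hδ1 ht htl hlL
  rw [← ha] at hmain
  calc Real.exp L * (x ^ j / j.factorial) ≤ Real.exp L * Real.exp (j * (3 - Real.log j)) := by gcongr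
    _ = Real.exp (L + j * (3 - Real.log j)) := by rw [← Real.exp_add]
    _ ≤ _ := by
      rw [Real.exp_le_exp]
      have h1 : (a - 1) * (l - t - 4) ≤ j * (l - t - 4) :=
        mul_le_mul_of_nonneg_right hja (by nlinarith)
      have h2 : (j : ℝ) * (3 - Real.log j) ≤ j * -(l - t - 4) := by gcongr; linarith
      linarith

/-- At the lower level, after `k` periods many vertices remain. -/
lemma cube_le_mul_pow (hl : l = Real.log L) (htdef : t = Real.log l)
    (hδ0 : 0 < δ) (hδ1 : δ ≤ 1) (ht : 8 ≤ δ * t) (htl : 16 * t ≤ δ * l)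
    {b : ℝ} (hb : 1 ≤ b) (htb : 2 * (1 + Real.log (8 * b)) ≤ δ * t)
    (hlL : 10 * l ^ 2 ≤ δ * L) {k : ℕ} (hk : k = ⌈(1 + (1 - δ) * (t / l)) * (L / l)⌉₊) {θ : ℝ}
    (hθ : 1 / (8 * b * k) ≤ θ) :
    1 ≤ (k : ℝ) ∧ (k : ℝ) ≤ 2 * L ∧ L ^ 3 ≤ Real.exp L * θ ^ k := by
  have ht0 : 8 ≤ t := by nlinarith
  have hl0 : 128 ≤ l := by nlinarith
  have hL0 : 0 < L := by nlinarith [sq_nonneg l]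
  have hz : 0 < L / l := by positivity
  have hz2 : 2 ≤ L / l := by
    rw [le_div_iff₀ (by linarith)]; nlinarith
  have htl' : t / l ≤ 1 / 16 := by
    rw [div_le_iff₀ (by linarith)]; nlinarith
  have htl0 : 0 ≤ t / l := by positivity
  have hlog8 : 0 ≤ Real.log (8 * b) := Real.log_nonneg (by linarith)
  set a := (1 + (1 - δ) * (t / l)) * (L / l) with ha
  have haz : L / l ≤ a := by
    rw [ha]
    refine le_mul_of_one_le_left hz.le ?_
    have : 0 ≤ (1 - δ) * (t / l) := mul_nonneg (by linarith) htl0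
    linarith
  have haz' : a ≤ 3 / 2 * (L / l) := by
    rw [ha]
    gcongr
    nlinarith
  have hka : a ≤ k := by rw [hk]; exact Nat.le_ceil a
  have hka' : (k : ℝ) ≤ a + 1 := by rw [hk]; exact (Nat.ceil_lt_add_one (by linarith)).le
  have hk1 : 1 ≤ (k : ℝ) := by linarith
  have hkz : (k : ℝ) ≤ 2 * (L / l) := by linarith
  have hzL : L / l ≤ L := div_le_self hL0.le (by linarith)
  refine ⟨hk1, by linarith, ?_⟩
  have hlogk : Real.log k ≤ l - t + 1 := by
    have h1 : Real.log k ≤ Real.log (2 * (L / l)) := Real.log_le_log (by linarith) hkz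
    rw [Real.log_mul (by norm_num) hz.ne', Real.log_div hL0.ne' (by linarith), ← hl, ← htdef] at h1
    have := Real.log_two_lt_d9
    linarith
  have hmain := lower_level_le hδ0 hδ1 ht htl htb hlL
  rw [← ha] at hmain
  have h1 : Real.exp (-(Real.log (8 * b) + Real.log k)) ≤ θ := by
    refine le_trans (le_of_eq ?_) hθ
    rw [← Real.log_mul (by linarith) (by linarith), Real.exp_neg, Real.exp_log (by positivity),
      one_div]
  calc L ^ 3 = Real.exp (3 * l) := by
        rw [hl, mul_comm, Real.exp_mul, Real.exp_log hL0]; norm_cast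
    _ ≤ Real.exp (L + k * -(Real.log (8 * b) + Real.log k)) := by
        rw [Real.exp_le_exp]
        have h2 : (k : ℝ) * (Real.log (8 * b) + Real.log k) ≤
            (a + 1) * (l - t + (1 + Real.log (8 * b))) := by
          have : 0 ≤ Real.log (k : ℝ) := Real.log_nonneg hk1
          exact mul_le_mul hka' (by linarith) (by linarith) (by linarith)
        linarith
    _ = Real.exp L * Real.exp (-(Real.log (8 * b) + Real.log k)) ^ k := by
        rw [Real.exp_add, ← Real.exp_nat_mul]
    _ ≤ _ := by gcongr

/-- A number between the two levels has the required form. -/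
lemma exists_error_of_mem_Icc (hL : 0 < L) (hl : 0 < l) (ht : 0 < t) {x : ℝ}
    (h1 : (1 + (1 - δ) * (t / l)) * (L / l) ≤ x) (h2 : x ≤ (1 + (1 + δ) * (t / l)) * (L / l)) :
    ∃ e : ℝ, |e| ≤ δ ∧ x = (1 + (1 + e) * (t / l)) * (L / l) := by
  refine ⟨(x / (L / l) - 1) / (t / l) - 1, ?_, by field_simp; ring⟩
  have hz : 0 < L / l := by positivity
  have hw : 0 < t / l := by positivity
  rw [← le_div_iff₀ hz] at h1
  rw [← div_le_iff₀ hz] at h2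
  rw [abs_le]
  constructor
  · have : 1 - δ ≤ (x / (L / l) - 1) / (t / l) := by rw [le_div_iff₀ hw]; linarith
    linarith
  · have : (x / (L / l) - 1) / (t / l) ≤ 1 + δ := by rw [div_le_iff₀ hw]; linarith
    linarith

end Asymptotics

universe u

/-- The assumptions on the walk hold on large `(n, d, lam)` graphs of large girth, with logarithmic
mixing time. -/
theorem exists_eventually_rapidMixing {d : ℕ} (hd : 3 ≤ d) {lam : ℝ} (hlam : lam < d) :
    ∃ C : ℝ, 0 < C ∧ ∀ᶠ n : ℕ in atTop, ∀ (V : Type u) [Fintype V] [DecidableEq V]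
      (G : SimpleGraph V) [DecidableRel G.Adj], IsNDLambda G n d lam →
      10 * Real.logb ((d : ℝ) - 1) (Real.log n) < (G.girth : ℝ) →
      RapidMixing G d n ⌈C * Real.log n⌉₊ (d / Real.log n ^ 5) := by
  obtain ⟨K, r, hK, hr0, hr1, hmix⟩ := exists_mixing hd hlam
  have hd' : (3 : ℝ) ≤ d := by exact_mod_cast hd
  have hlogr : 0 < -Real.log r := neg_pos.2 (Real.log_neg hr0 hr1)
  -- After this multiple of log n steps r^s ≤ n⁻³. The factors `K` and √n are each at most √n, which
  -- leaves n⁻².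
  refine ⟨3 / -Real.log r, by positivity, ?_⟩
  have hlog : Tendsto (fun n : ℕ => Real.log n) atTop atTop :=
    Real.tendsto_log_atTop.comp tendsto_natCast_atTop_atTop
  filter_upwards [eventually_ge_atTop 1, hlog.eventually_ge_atTop 1,
    tendsto_natCast_atTop_atTop.eventually_ge_atTop (K ^ 2)] with n hn hL hnK
  intro V _ _ G _ hG hgirth
  have hn1 : (1 : ℝ) ≤ n := by exact_mod_cast hn
  set L := Real.log n with hLdef
  set τ := ⌈3 / -Real.log r * L⌉₊ with hτ
  refine ⟨hd, hG.regular, hG.card_eq, hn, Nat.one_le_ceil_iff.2 (by positivity), by positivity,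
    ?_, ?_⟩
  · intro p c hp W s hs
    refine (hmix n V G hG p c hp W s).trans ?_
    have h1 : r ^ s ≤ ((n : ℝ) ^ 3)⁻¹ := by
      calc r ^ s = Real.exp (s * Real.log r) := by
            rw [mul_comm, Real.exp_mul, Real.exp_log hr0, Real.rpow_natCast]
        _ ≤ Real.exp (-(3 * L)) := by
            rw [Real.exp_le_exp]
            have h2 : 3 / -Real.log r * L ≤ s := (Nat.le_ceil _).trans (by exact_mod_cast hs)
            rw [div_mul_eq_mul_div, div_le_iff₀ hlogr] at h2
            linarith
        _ = ((n : ℝ) ^ 3)⁻¹ := by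
            rw [Real.exp_neg, mul_comm, Real.exp_mul, hLdef, Real.exp_log (by linarith)]
            norm_cast
    have h2 : K ≤ √n := Real.le_sqrt_of_sq_le hnK
    calc K * r ^ s * √n ≤ √n * ((n : ℝ) ^ 3)⁻¹ * √n := by gcongr
      _ = (√n * √n) * ((n : ℝ) ^ 3)⁻¹ := by ring
      _ = 1 / (n : ℝ) ^ 2 := by
          rw [Real.mul_self_sqrt (by linarith)]
          field_simp
  · intro p x hp s hs
    have hb : 1 < (d : ℝ) - 1 := by linarith
    have hlogb : 0 ≤ Real.logb ((d : ℝ) - 1) L := Real.logb_nonneg hb hL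
    have hg0 : 0 < G.girth := by
      have : (0 : ℝ) < G.girth := by linarith
      exact_mod_cast this
    -- The largest `h` with `2 * h` below the girth. Then h + 1 is at least half the girth, so (d −
    -- 1)^(h+1) ≥ L⁵; the extra factor d − 1 accounts for the `d` in `q`.
    obtain ⟨h, hh1, hh2⟩ : ∃ h : ℕ, 2 * h < G.girth ∧ G.girth ≤ 2 * h + 2 :=
      ⟨(G.girth - 1) / 2, by omega, by omega⟩
    refine (marginal_return_le hd hG.regular hh1 hp hs).trans ?_
    have hh3 : (G.girth : ℝ) ≤ 2 * h + 2 := by exact_mod_cast hh2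
    have hpow : L ^ 5 ≤ ((d : ℝ) - 1) ^ (h + 1) := by
      rw [← Real.rpow_natCast ((d : ℝ) - 1), ← Real.rpow_natCast L]
      nth_rewrite 1 [← Real.rpow_logb (b := (d : ℝ) - 1) (by linarith) (by linarith)
        (by linarith : 0 < L)]
      rw [← Real.rpow_mul (by linarith)]
      apply Real.rpow_le_rpow_of_exponent_le hb.le
      push_cast
      linarith
    have hp0 : 0 < ((d : ℝ) - 1) ^ h := by positivity
    rw [inv_pow, ← one_div, div_le_div_iff₀ hp0 (by positivity)]
    rw [pow_succ ((d : ℝ) - 1)] at hpow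
    nlinarith

end NonBacktracking

/-! ### Conclusion: both levels with high probability, and diagonalization. -/

namespace NonBacktracking

universe u

/-- The event that the maximal number of visits is as predicted, up to a relative error `ε` in the
second-order term. -/
def goodLists (V : Type u) [Fintype V] [DecidableEq V] (n : ℕ) (ε : ℝ) : Set (List V) :=
  {l | ∃ e : ℝ, |e| ≤ ε ∧
    (maxVisits l : ℝ) =
      (1 + (1 + e) * (Real.log (Real.log (Real.log n)) / Real.log (Real.log n))) *
        (Real.log n / Real.log (Real.log n))}

/-- A lower bound for the probability of the predicted event, from the two tail bounds. -/
lemma ofReal_le_toOuterMeasure_goodLists {V : Type u} [Fintype V] [DecidableEq V]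
    {G : SimpleGraph V} [DecidableRel G.Adj] {d n j k : ℕ} (hd : 3 ≤ d)
    (hG : G.IsRegularOfDegree d) {δ : ℝ}
    (hL : 0 < Real.log n) (hl : 0 < Real.log (Real.log n))
    (ht : 0 < Real.log (Real.log (Real.log n)))
    (hj : j = ⌊(1 + (1 + δ) * (Real.log (Real.log (Real.log n)) / Real.log (Real.log n))) *
        (Real.log n / Real.log (Real.log n))⌋₊)
    (hk : k = ⌈(1 + (1 - δ) * (Real.log (Real.log (Real.log n)) / Real.log (Real.log n))) *
        (Real.log n / Real.log (Real.log n))⌉₊)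
    (hδ : 0 ≤ δ) {w₀ : V} {a b : ℝ} (hab : a + b ≤ δ)
    (h1 : expect G n none w₀ (fun l => if j + 1 ≤ maxVisits l then 1 else 0) ≤ a)
    (h2 : expect G n none w₀ (fun l => if k ≤ maxVisits l then 0 else 1) ≤ b) :
    ENNReal.ofReal (1 - δ) ≤ (walk G w₀ n).toOuterMeasure (goodLists V n δ) := by
  classical
  refine ENNReal.ofReal_le_of_le_toReal ?_
  rw [walk, toReal_walkFrom]
  have hpt : ∀ l : List V, (1 : ℝ) ≤ ((if l ∈ goodLists V n δ then 1 else 0) +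
      (if j + 1 ≤ maxVisits l then 1 else 0)) + (if k ≤ maxVisits l then 0 else 1) := by
    intro l
    by_cases hgood : l ∈ goodLists V n δ
    · rw [if_pos hgood]
      split_ifs <;> norm_num
    · by_cases hkl : k ≤ maxVisits l
      · by_cases hjl : j + 1 ≤ maxVisits l
        · rw [if_neg hgood, if_pos hkl, if_pos hjl]; norm_num
        · refine absurd (exists_error_of_mem_Icc hL hl ht ?_ ?_) hgood
          · exact (Nat.le_ceil _).trans (by rw [← hk]; exact_mod_cast hkl)
          · have h3 : maxVisits l ≤ j := by omega
            refine le_trans (b := (j : ℝ)) (by exact_mod_cast h3) ?_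
            rw [hj]
            exact Nat.floor_le (by positivity)
      · rw [if_neg hkl]
        split_ifs <;> norm_num
  have h3 := expect_mono hd hG (adm_none w₀) (k := n) fun l _ _ => hpt l
  rw [expect_const, expect_add, expect_add] at h3
  linarith

namespace RapidMixing

variable {V : Type u} [Fintype V] [DecidableEq V] {G : SimpleGraph V} [DecidableRel G.Adj]
variable {d n τ : ℕ} {q L l t δ c : ℝ}

/-- The upper level is rarely exceeded. -/
lemma expect_upper_level_le (h : RapidMixing G d n τ q) (hn : Real.exp L = n)
    (hl : l = Real.log L) (htdef : t = Real.log l) (hδ0 : 0 < δ) (hδ1 : δ ≤ 1) (ht : 8 ≤ δ * t)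
    (htl : 16 * t ≤ δ * l) (hlL : 10 * l ^ 2 ≤ δ * L) (hc : c ≤ L) (hL1 : 1 ≤ L)
    (hτq : τ * q ≤ c / L ^ 4) {j : ℕ} (hj : j = ⌊(1 + (1 + δ) * (t / l)) * (L / l)⌋₊) (w₀ : V) :
    expect G n none w₀ (fun l => if j + 1 ≤ maxVisits l then 1 else 0) ≤
      Real.exp (-(δ / 8 * (L / l))) := by
  have ht0 : 8 ≤ t := by nlinarith
  have hl0 : 128 ≤ l := by nlinarith
  have hn0 : (0 : ℝ) < n := by rw [← hn]; positivity
  have hq := h.nonneg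
  have htl0 : 0 ≤ t / l := by positivity
  have htl1 : t / l ≤ 1 / 16 := by
    rw [div_le_iff₀ (by linarith)]; nlinarith
  have hzL : L / l ≤ L / 2 := by gcongr; linarith
  have hz0 : 0 < L / l := by positivity
  have hjL : (j : ℝ) ≤ L := by
    rw [hj]
    refine (Nat.floor_le (by positivity)).trans ?_
    have : 1 + (1 + δ) * (t / l) ≤ 2 := by nlinarith
    calc (1 + (1 + δ) * (t / l)) * (L / l) ≤ 2 * (L / 2) := by gcongr
      _ = L := by ring
  refine (h.expect_maxVisits_ge_le j n (adm_none w₀)).trans ?_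
  rw [div_mul_cancel₀ _ hn0.ne', ← hn]
  refine exp_mul_pow_div_factorial_le hl htdef hδ0 hδ1 ht htl
    (by linarith [sq_nonneg l]) hj (by positivity) ?_
  have h1 : (j : ℝ) * (τ * q) ≤ L * (c / L ^ 4) := by gcongr
  have h2 : L * (c / L ^ 4) ≤ 1 := by
    rw [mul_div_assoc', div_le_one (by positivity)]
    calc L * c ≤ L * L := by gcongr
      _ = L ^ 2 := by ring
      _ ≤ L ^ 4 := pow_le_pow_right₀ hL1 (by norm_num)
  linarith

/-- The lower level is attained with high probability. -/
lemma expect_lower_level_le (h : RapidMixing G d n τ q) (hn : Real.exp L = n)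
    (hl : l = Real.log L) (htdef : t = Real.log l) (hδ0 : 0 < δ) (hδ1 : δ ≤ 1) (ht : 8 ≤ δ * t)
    (htl : 16 * t ≤ δ * l) (hlL : 10 * l ^ 2 ≤ δ * L) (hc0 : 0 ≤ c) (hc : c ≤ L) (hL1 : 1 ≤ L)
    (hτ : τ ≤ c * L) (hτq : τ * q ≤ c / L ^ 4) {b : ℕ} (hb1 : (1 : ℝ) ≤ b)
    (htb : 2 * (1 + Real.log (8 * b)) ≤ δ * t) (hLb : 8 * b ≤ L)
    {k : ℕ} (hk : k = ⌈(1 + (1 - δ) * (t / l)) * (L / l)⌉₊) (w₀ : V) :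
    expect G n none w₀ (fun l => if k ≤ maxVisits l then 0 else 1) ≤ 64 * (c / L) + 24 / b := by
  have hL0 : 0 < L := by linarith
  have hn0 : (0 : ℝ) < n := by rw [← hn]; positivity
  have hq := h.nonneg
  -- The bounds on `k` do not involve θ, so they are extracted with the extreme value of θ. They are
  -- needed to bound `T`, hence the actual θ, from below.
  obtain ⟨hk1, hkL, -⟩ := cube_le_mul_pow hl htdef hδ0 hδ1 ht htl hb1 htb hlL hk le_rfl
  have hk0 : 0 < k := by exact_mod_cast (by linarith : (0 : ℝ) < k)
  have hbnat : 0 < b := by exact_mod_cast (by linarith : (0 : ℝ) < b)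
  have hb0 : (0 : ℝ) < b := by linarith
  have hkb0 : (0 : ℝ) < k * b := by positivity
  -- All `k` periods together use at most a fraction 1/b of the time, so the failure terms 24T/n add
  -- up to at most 24/b.
  set T := n / (k * b) with hT
  set θ : ℝ := T / (4 * n) with hθ
  have hTlow : (n : ℝ) / (2 * (k * b)) ≤ T := by
    have h1 : (n : ℝ) < (T + 1) * (k * b) := by
      have : n < (T + 1) * (k * b) := by
        rw [hT, mul_comm]
        exact Nat.lt_mul_div_succ n (Nat.mul_pos hk0 hbnat)
      exact_mod_cast this
    have h2 : 2 * (k * b) ≤ (n : ℝ) := by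
      have h3 := Real.quadratic_le_exp_of_nonneg hL0.le
      rw [hn] at h3
      have h4 : (k : ℝ) * b ≤ 2 * L * b := by gcongr
      have h5 : 8 * b * L ≤ L * L := by gcongr
      linarith
    rw [div_le_iff₀ (by positivity)]
    linarith
  have hθlow : 1 / (8 * b * k) ≤ θ := by
    rw [hθ, le_div_iff₀ (by positivity)]
    refine le_trans (le_of_eq ?_) hTlow
    field_simp
    ring
  obtain ⟨-, -, hcube⟩ := cube_le_mul_pow hl htdef hδ0 hδ1 ht htl hb1 htb hlL hk hθlow
  rw [hn] at hcube
  have hTn : T ≤ n := Nat.div_le_self _ _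
  have hkbT : k * b * T ≤ n := Nat.mul_div_le n (k * b)
  have hkT : k * T ≤ n := by
    refine le_trans ?_ hkbT
    rw [mul_right_comm]
    exact Nat.le_mul_of_pos_right _ hbnat
  have hL3 : 0 < L ^ 3 := by positivity
  have hτk : (τ : ℝ) ≤ 4 * (n * θ ^ k) := by
    have h1 : c * L ≤ L * L := by gcongr
    have h2 : L * L ≤ L ^ 3 := by
      rw [← pow_two]; exact pow_le_pow_right₀ hL1 (by norm_num)
    linarith
  refine (h.expect_maxVisits_lt_le hkT hTn hθ hτk).trans ?_
  have e1 : (k : ℝ) * (20 * τ / (n * θ ^ k)) ≤ 40 * (c / L) := by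
    calc (k : ℝ) * (20 * τ / (n * θ ^ k)) ≤ 2 * L * (20 * (c * L) / L ^ 3) := by gcongr
      _ = 40 * (c / L) := by field_simp; ring
  have e2 : (k : ℝ) * (12 * (2 / n * T)) ≤ 24 / b := by
    have h1 : (k : ℝ) * b * T ≤ n := by exact_mod_cast hkbT
    have h2 : (k : ℝ) * T / n ≤ 1 / b := by
      rw [div_le_div_iff₀ hn0 hb0]
      linarith
    calc (k : ℝ) * (12 * (2 / n * T)) = 24 * (k * T / n) := by ring
      _ ≤ 24 * (1 / b) := by gcongr
      _ = 24 / b := by ring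
  have e3 : (k : ℝ) * (12 * (τ * q)) ≤ 24 * (c / L) := by
    calc (k : ℝ) * (12 * (τ * q)) ≤ 2 * L * (12 * (c / L ^ 4)) := by gcongr
      _ = 24 * (c / L) * (1 / L ^ 2) := by field_simp; ring
      _ ≤ 24 * (c / L) * 1 := by
          have : 1 / L ^ 2 ≤ 1 := by
            rw [div_le_one (by positivity)]; exact one_le_pow₀ hL1
          gcongr
      _ = _ := mul_one _
  linarith

end RapidMixing

/-- For each fixed error, the prediction holds with high probability on all large graphs. -/
theorem eventually_goodLists {d : ℕ} (hd : 3 ≤ d) {lam : ℝ} (hlam : lam < d) {δ : ℝ} (hδ0 : 0 < δ)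
    (hδ1 : δ ≤ 1) :
    ∀ᶠ n : ℕ in atTop, ∀ (V : Type u) [Fintype V] [DecidableEq V]
      (G : SimpleGraph V) [DecidableRel G.Adj], IsNDLambda G n d lam →
      10 * Real.logb ((d : ℝ) - 1) (Real.log n) < (G.girth : ℝ) →
      ∀ w₀ : V, ENNReal.ofReal (1 - δ) ≤ (walk G w₀ n).toOuterMeasure (goodLists V n δ) := by
  obtain ⟨C, hC, hRM⟩ := exists_eventually_rapidMixing.{u} hd hlam
  have hd' : (3 : ℝ) ≤ d := by exact_mod_cast hd
  -- This makes 24/b at most δ/4. The term does not vanish as n grows, so `b` has to depend on `δ`.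
  obtain ⟨b, hb⟩ := exists_nat_gt (96 / δ)
  have hb0 : (0 : ℝ) < b := lt_trans (by positivity) hb
  have hb1 : (1 : ℝ) ≤ b := by
    have : 0 < b := by exact_mod_cast hb0
    exact_mod_cast this
  have hlogn : Tendsto (fun n : ℕ => Real.log n) atTop atTop :=
    Real.tendsto_log_atTop.comp tendsto_natCast_atTop_atTop
  have hlog2 : Tendsto (fun n : ℕ => Real.log (Real.log n)) atTop atTop :=
    Real.tendsto_log_atTop.comp hlogn
  have hlog3 : Tendsto (fun n : ℕ => Real.log (Real.log (Real.log n))) atTop atTop :=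
    Real.tendsto_log_atTop.comp hlog2
  have hlo1 : ∀ᶠ x : ℝ in atTop, 16 * Real.log x ≤ δ * x := by
    filter_upwards [Real.isLittleO_log_id_atTop.bound (by positivity : 0 < δ / 16),
      eventually_ge_atTop 0] with x hx hx0
    rw [Real.norm_eq_abs, id, Real.norm_eq_abs, abs_of_nonneg hx0] at hx
    linarith [le_of_abs_le hx]
  have hlo2 : ∀ᶠ x : ℝ in atTop, 10 * Real.log x ^ 2 ≤ δ * x := by
    filter_upwards [(Real.isLittleO_pow_log_id_atTop (n := 2)).bound (by positivity : 0 < δ / 10),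
      eventually_ge_atTop 0] with x hx hx0
    rw [Real.norm_eq_abs, id, Real.norm_eq_abs, abs_of_nonneg hx0] at hx
    linarith [le_of_abs_le hx]
  have hlo3 : ∀ᶠ x : ℝ in atTop, Real.exp (-(δ / 8 * (x / Real.log x))) ≤ δ / 4 := by
    have h1 : Tendsto (fun x : ℝ => Real.log x) atTop atTop := Real.tendsto_log_atTop
    filter_upwards [hlo2, eventually_gt_atTop 0, h1.eventually_gt_atTop 0,
      h1.eventually_ge_atTop (-Real.log (δ / 4))] with x h2 h3 h4 h5
    rw [← Real.le_log_iff_exp_le (by positivity)]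
    have h6 : Real.log x ≤ δ / 8 * (x / Real.log x) := by
      rw [div_mul_div_comm, le_div_iff₀ (by positivity)]
      nlinarith [sq_nonneg (Real.log x)]
    linarith
  filter_upwards [hRM, eventually_ge_atTop 1, hlog3.eventually_ge_atTop (8 / δ),
    hlog3.eventually_ge_atTop (2 * (1 + Real.log (8 * b)) / δ),
    hlog2.eventually hlo1, hlogn.eventually hlo2, hlogn.eventually hlo3,
    hlogn.eventually_ge_atTop 1, hlogn.eventually_ge_atTop (8 * b),
    hlogn.eventually_ge_atTop (384 * (C + 1) * d / δ)] with n hRM hn0 ht htb htl hlL hexp hL1 hLb hLC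
  intro V _ _ G _ hG hgirth w₀
  have h := hRM V G hG hgirth
  rw [div_le_iff₀' hδ0] at ht htb hLC
  have hexpL : Real.exp (Real.log n) = n := Real.exp_log (by exact_mod_cast hn0)
  set L := Real.log n with hL
  have hL0 : 0 < L := by linarith
  have hc0 : 0 ≤ (C + 1) * d := by positivity
  have hc : (C + 1) * d ≤ L := by nlinarith
  have hC1 : C + 1 ≤ (C + 1) * d := le_mul_of_one_le_right (by linarith) (by linarith)
  have hτle : (⌈C * L⌉₊ : ℝ) ≤ (C + 1) * L := by
    have := (Nat.ceil_lt_add_one (by positivity : 0 ≤ C * L)).le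
    linarith
  have hτq : (⌈C * L⌉₊ : ℝ) * (d / L ^ 5) ≤ (C + 1) * d / L ^ 4 := by
    calc (⌈C * L⌉₊ : ℝ) * (d / L ^ 5) ≤ (C + 1) * L * (d / L ^ 5) := by gcongr
      _ = (C + 1) * d / L ^ 4 := by field_simp
  have ht0 : 0 < Real.log (Real.log L) := by
    by_contra hcon
    nlinarith
  have hl0 : 0 < Real.log L := by
    by_contra hcon
    nlinarith
  refine ofReal_le_toOuterMeasure_goodLists hd hG.regular hL0 hl0 ht0 rfl rfl
    hδ0.le (a := δ / 4) (b := 3 * δ / 4) (by linarith) ?_ ?_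
  · exact (h.expect_upper_level_le hexpL rfl rfl hδ0 hδ1 ht htl hlL hc hL1 hτq rfl w₀).trans
      hexp
  · refine (h.expect_lower_level_le hexpL rfl rfl hδ0 hδ1 ht htl hlL hc0 hc hL1
      (hτle.trans (by gcongr)) hτq hb1 htb hLb rfl w₀).trans ?_
    have h1 : (C + 1) * d / L ≤ δ / 384 := by
      rw [div_le_div_iff₀ hL0 (by norm_num)]
      linarith
    have h2 : 24 / (b : ℝ) ≤ δ / 4 := by
      rw [div_lt_iff₀ hδ0] at hb
      rw [div_le_div_iff₀ hb0 (by norm_num)]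
      linarith
    linarith

/-- Diagonalization over the errors `1 / (j + 1)`. -/
lemma exists_tendsto_zero_of_eventually {Q : ℕ → ℝ → Prop} (h1 : ∀ n, Q n 1)
    (h : ∀ δ, 0 < δ → δ ≤ 1 → ∀ᶠ n in atTop, Q n δ) :
    ∃ ε : ℕ → ℝ, Tendsto ε atTop (𝓝 0) ∧ ∀ n, Q n (ε n) := by
  classical
  set P : ℕ → ℕ → Prop := fun n j => Q n (1 / ((j : ℝ) + 1)) with hP
  have hJ : Tendsto (fun n => Nat.findGreatest (P n) n) atTop atTop := by
    rw [tendsto_atTop]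
    intro m
    have hm : (1 : ℝ) / (m + 1) ≤ 1 := by
      rw [div_le_one (by positivity)]
      linarith [(Nat.cast_nonneg m : (0 : ℝ) ≤ m)]
    filter_upwards [h (1 / (m + 1)) (by positivity) hm, eventually_ge_atTop m] with n hn hmn
    exact Nat.le_findGreatest hmn hn
  refine ⟨fun n => 1 / ((Nat.findGreatest (P n) n : ℝ) + 1),
    tendsto_one_div_add_atTop_nhds_zero_nat.comp hJ, fun n => ?_⟩
  -- `Nat.findGreatest` defaults to 0, where the property is `Q n 1` and holds by assumption.
  exact Nat.findGreatest_spec (P := P n) (Nat.zero_le n) (by simpa [hP] using h1 n)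

end NonBacktracking

theorem corollary5 (d : ℕ) (hd : 3 ≤ d) (lam : ℝ) (hlam : lam < d) :
    ∃ (ε : ℕ → ℝ) (p : ℕ → ℝ≥0∞), Tendsto ε atTop (𝓝 0) ∧ Tendsto p atTop (𝓝 1) ∧
      ∀ (n : ℕ) (V : Type*) [Fintype V] [DecidableEq V] (G : SimpleGraph V) [DecidableRel G.Adj],
        NonBacktracking.IsNDLambda G n d lam →
        10 * Real.logb ((d : ℝ) - 1) (Real.log n) < (G.girth : ℝ) →
        ∀ w₀ : V,
          p n ≤ (NonBacktracking.walk G w₀ n).toOuterMeasure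
            {l | ∃ e : ℝ, |e| ≤ ε n ∧
              (NonBacktracking.maxVisits l : ℝ) =
                (1 + (1 + e) * (Real.log (Real.log (Real.log n)) / Real.log (Real.log n))) *
                  (Real.log n / Real.log (Real.log n))} := by
  obtain ⟨ε, hε, hgood⟩ := NonBacktracking.exists_tendsto_zero_of_eventually
    (Q := fun n δ => ∀ (V : Type _) [Fintype V] [DecidableEq V]
      (G : SimpleGraph V) [DecidableRel G.Adj], NonBacktracking.IsNDLambda G n d lam →
      10 * Real.logb ((d : ℝ) - 1) (Real.log n) < (G.girth : ℝ) →
      ∀ w₀ : V, ENNReal.ofReal (1 - δ) ≤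
        (NonBacktracking.walk G w₀ n).toOuterMeasure (NonBacktracking.goodLists V n δ))
    -- At error 1 the required probability is 1 − 1 = 0.
    (fun n V _ _ G _ _ _ w₀ => by simp)
    (fun δ hδ0 hδ1 => NonBacktracking.eventually_goodLists hd hlam hδ0 hδ1)
  refine ⟨ε, fun n => ENNReal.ofReal (1 - ε n), hε, ?_, fun n V _ _ G _ => hgood n V G⟩
  have h := ENNReal.tendsto_ofReal (hε.const_sub 1)
  simpa using h
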